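/- **Theorem 1.1.** Let $M$ be a closed smooth $n$-dimensional manifold, let $T>0$, and let $g(t)$, $t\in[0,T]$, be a smooth one-parameter family of Riemannian metrics on $M$ with $$\frac{\partial g}{\partial t}=-2\alpha ,$$ where $\alpha(t)$, $t\in[0,T]$, is a smooth one-parameter family of symmetric $2$-tensors on $M$. Put $S=\operatorname{tr}_{g}\alpha=g^{ij}\alpha_{ij}$ and $\tau=T-t$. All of $\nabla$, $\Delta$, $\mathrm{Rc}$, norms and traces are taken with respect to $g(t)$. For a tangent vector $V$ let $$\mathcal D_\alpha(V)=\frac{\partial S}{\partial t}-\Delta S-2|\alpha|^2+2(\mathrm{Rc}-\alpha)(V,V)+\langle 4\operatorname{Div}(\alpha)-2\nabla S,V\rangle ,\qquad \operatorname{Div}(\alpha)_k=g^{ij}\nabla_i\alpha_{jk},$$ and let $$\Box^*=-\frac{\partial}{\partial t}-\Delta+S .$$ Let $f$ be a smooth real-valued function on $[0,T)\times M$ such that $u=(4\pi\tau)^{-n/2}e^{-f}$ satisfies $\Box^*u=0$ on $[0,T)\times M$, and set $$v=\Big(\tau\big(2\Delta f-|\nabla f|^2+S\big)+f-n\Big)u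 .$$ Then $v$ is smooth and, on $[0,T)\times M$, $$\Box^*v=-2\tau u\,\Big|\alpha+\nabla\nabla f-\frac{g}{2\tau}\Big|^2-\tau u\,\mathcal D_\alpha(\nabla f).$$ (At $t=0$ time derivatives are one-sided.) -/

import Mathlib

open Set Bundle
open scoped Manifold ContDiff

noncomputable section

namespace EvolvingMetric

/-! ### Riemannian geometry in coordinates

`G : ℝⁿ → Mat(n, ℝ)` is the coordinate expression `(g_ij)` of a metric; `(G y)⁻¹ i j` is `g^{ij}`. -/

/-- The partial derivative `∂_i F` at `y`. -/
def partialDeriv {n : ℕ} (i : Fin n) (F : EuclideanSpace ℝ (Fin n) → ℝ)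
    (y : EuclideanSpace ℝ (Fin n)) : ℝ :=
  fderiv ℝ F y (EuclideanSpace.single i 1)

/-- The Christoffel symbol `Γ^k_ij = ½ g^{kl} (∂_i g_jl + ∂_j g_il - ∂_l g_ij)`. -/
def christoffel {n : ℕ} (G : EuclideanSpace ℝ (Fin n) → Matrix (Fin n) (Fin n) ℝ)
    (k i j : Fin n) (y : EuclideanSpace ℝ (Fin n)) : ℝ :=
  (1 / 2) * ∑ l, (G y)⁻¹ k l *
    (partialDeriv i (fun z => G z j l) y + partialDeriv j (fun z => G z i l) y
      - partialDeriv l (fun z => G z i j) y)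

/-- `∇_i ∇_j F = ∂_i ∂_j F - Γ^k_ij ∂_k F`. -/
def coordHess {n : ℕ} (G : EuclideanSpace ℝ (Fin n) → Matrix (Fin n) (Fin n) ℝ)
    (F : EuclideanSpace ℝ (Fin n) → ℝ) (y : EuclideanSpace ℝ (Fin n)) :
    Matrix (Fin n) (Fin n) ℝ :=
  Matrix.of fun i j => partialDeriv i (partialDeriv j F) y - ∑ k, christoffel G k i j y * partialDeriv k F y

/-- `R_jk = ∂_i Γ^i_jk - ∂_j Γ^i_ik + Γ^i_ip Γ^p_jk - Γ^i_jp Γ^p_ik`. -/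
def coordRicci {n : ℕ} (G : EuclideanSpace ℝ (Fin n) → Matrix (Fin n) (Fin n) ℝ)
    (y : EuclideanSpace ℝ (Fin n)) : Matrix (Fin n) (Fin n) ℝ :=
  Matrix.of fun j k =>
    ∑ i, (partialDeriv i (christoffel G i j k) y - partialDeriv j (christoffel G i i k) y
      + ∑ p, (christoffel G i i p y * christoffel G p j k y
        - christoffel G i j p y * christoffel G p i k y))

/-- `∇_i A_jk = ∂_i A_jk - Γ^p_ij A_pk - Γ^p_ik A_jp` for a 2-tensor `A`. -/
def coordCovDeriv {n : ℕ} (G A : EuclideanSpace ℝ (Fin n) → Matrix (Fin n) (Fin n) ℝ)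
    (i j k : Fin n) (y : EuclideanSpace ℝ (Fin n)) : ℝ :=
  partialDeriv i (fun z => A z j k) y
    - ∑ p, (christoffel G p i j y * A y p k + christoffel G p i k y * A y j p)

/-- `Div(A)_k = g^{ij} ∇_i A_jk`. -/
def coordDiv {n : ℕ} (G A : EuclideanSpace ℝ (Fin n) → Matrix (Fin n) (Fin n) ℝ)
    (k : Fin n) (y : EuclideanSpace ℝ (Fin n)) : ℝ :=
  ∑ i, ∑ j, (G y)⁻¹ i j * coordCovDeriv G A i j k y

/-- The trace `g^{ij} A_ij`. -/
def coordTrace {n : ℕ} (G A : Matrix (Fin n) (Fin n) ℝ) : ℝ :=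
  ∑ i, ∑ j, G⁻¹ i j * A i j

/-- The squared norm `g^{ik} g^{jl} A_ij A_kl`. -/
def coordNormSq {n : ℕ} (G A : Matrix (Fin n) (Fin n) ℝ) : ℝ :=
  ∑ i, ∑ j, ∑ k, ∑ l, G⁻¹ i k * G⁻¹ j l * A i j * A k l

/-! ### Tensors on a manifold

Geometric quantities at `x` are computed from the components in the preferred chart at `x`. -/

section Manifold

variable {n : ℕ} {M : Type*} [TopologicalSpace M] [ChartedSpace (EuclideanSpace ℝ (Fin n)) M]

/-- Fields of bilinear forms on the tangent spaces of `M`, i.e. (not necessarily smooth)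
covariant 2-tensors. -/
abbrev TwoTensor (n : ℕ) (M : Type*) [TopologicalSpace M]
    [ChartedSpace (EuclideanSpace ℝ (Fin n)) M] : Type _ :=
  (x : M) → TangentSpace (𝓡 n) x →L[ℝ] TangentSpace (𝓡 n) x →L[ℝ] ℝ

/-- The coordinate expression of a function in the chart at `p`. -/
def localFun (f : M → ℝ) (p : M) : EuclideanSpace ℝ (Fin n) → ℝ :=
  fun y => f ((extChartAt (𝓡 n) p).symm y)

/-- The coordinate vector field `∂_i` of the chart at `p`, at the point with coordinates `y`. -/
def coordVec (p : M) (i : Fin n) (y : EuclideanSpace ℝ (Fin n)) :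
    TangentSpace (𝓡 n) ((extChartAt (𝓡 n) p).symm y) :=
  mfderiv 𝓘(ℝ, EuclideanSpace ℝ (Fin n)) (𝓡 n) (extChartAt (𝓡 n) p).symm y
    ((NormedSpace.fromTangentSpace y).symm (EuclideanSpace.single i (1 : ℝ)))

/-- The components `A_ij = A(∂_i, ∂_j)` of a 2-tensor in the chart at `p`. -/
def localTensor (A : TwoTensor n M) (p : M) (y : EuclideanSpace ℝ (Fin n)) :
    Matrix (Fin n) (Fin n) ℝ :=
  Matrix.of fun i j => A ((extChartAt (𝓡 n) p).symm y) (coordVec p i y) (coordVec p j y)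

/-- The components of a 2-tensor at `x`, in the chart at `x`. -/
def tensorAt (A : TwoTensor n M) (x : M) : Matrix (Fin n) (Fin n) ℝ :=
  localTensor A x (extChartAt (𝓡 n) x x)

/-- The components `V^i` of a tangent vector at `x`, in the chart at `x`. -/
def vecAt (x : M) (V : TangentSpace (𝓡 n) x) (i : Fin n) : ℝ :=
  mvfderiv (𝓡 n) (extChartAt (𝓡 n) x) x V i

/-- The components of the Hessian `∇∇f` at `x`, in the chart at `x`. -/
def hessAt (g : TwoTensor n M) (f : M → ℝ) (x : M) : Matrix (Fin n) (Fin n) ℝ :=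
  coordHess (localTensor g x) (localFun f x) (extChartAt (𝓡 n) x x)

/-- The components of the Ricci tensor at `x`, in the chart at `x`. -/
def ricciAt (g : TwoTensor n M) (x : M) : Matrix (Fin n) (Fin n) ℝ :=
  coordRicci (localTensor g x) (extChartAt (𝓡 n) x x)

/-- The components of the 1-form `Div(A)` at `x`, in the chart at `x`. -/
def divAt (g A : TwoTensor n M) (x : M) (k : Fin n) : ℝ :=
  coordDiv (localTensor g x) (localTensor A x) k (extChartAt (𝓡 n) x x)

/-- The trace `tr_g A`, a function on `M`. -/
def traceOf (g A : TwoTensor n M) (x : M) : ℝ :=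
  coordTrace (tensorAt g x) (tensorAt A x)

/-- The Laplace–Beltrami operator `Δ f = tr_g ∇∇f`. -/
def laplaceBeltrami (g : TwoTensor n M) (f : M → ℝ) (x : M) : ℝ :=
  coordTrace (tensorAt g x) (hessAt g f x)

/-- The gradient `∇f`: the tangent vector that `V ↦ g(V, ·)` sends to the differential of `f`. -/
def riemGradient (g : TwoTensor n M) (f : M → ℝ) (x : M) : TangentSpace (𝓡 n) x :=
  (g x).inverse (mvfderiv (𝓡 n) f x)

/-- Müller's quantity at time `t ∈ [0, T)`, for a tangent vector `V` at `x`: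
`∂S/∂t - ΔS - 2|α|² + 2(Rc - α)(V, V) + ⟨4 Div(α) - 2∇S, V⟩`, where `S = tr_g α`. -/
def muellerD (T : ℝ) (g α : ℝ → TwoTensor n M) (t : ℝ) (x : M) (V : TangentSpace (𝓡 n) x) : ℝ :=
  derivWithin (fun s => traceOf (g s) (α s) x) (Ico 0 T) t
    - laplaceBeltrami (g t) (traceOf (g t) (α t)) x
    - 2 * coordNormSq (tensorAt (g t) x) (tensorAt (α t) x)
    + 2 * (∑ i, ∑ j, (ricciAt (g t) x - tensorAt (α t) x) i j * vecAt x V i * vecAt x V j)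
    + (4 * (∑ k, divAt (g t) (α t) x k * vecAt x V k)
      - 2 * g t x (riemGradient (g t) (traceOf (g t) (α t)) x) V)

/-- The conjugate heat operator `□* w = -∂w/∂t - Δw + S w` at time `t ∈ [0, T)`, where
`S = tr_g α`. The time derivative is one-sided at `t = 0`. -/
def conjHeat (T : ℝ) (g α : ℝ → TwoTensor n M) (w : ℝ → M → ℝ) (t : ℝ) (x : M) : ℝ :=
  -derivWithin (fun s => w s x) (Ico 0 T) t - laplaceBeltrami (g t) (w t) x
    + traceOf (g t) (α t) x * w t x

/-- `(t, x) ↦ w t x` is smooth on `J × M`. -/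
def SmoothFunOn (n : ℕ) {M : Type*} [TopologicalSpace M]
    [ChartedSpace (EuclideanSpace ℝ (Fin n)) M] (J : Set ℝ) (w : ℝ → M → ℝ) : Prop :=
  ContMDiffOn (𝓘(ℝ, ℝ).prod (𝓡 n)) 𝓘(ℝ, ℝ) ∞ (fun p : ℝ × M => w p.1 p.2) (J ×ˢ univ)

/-- `(t, x) ↦ A t x`, as a map to the bundle of bilinear forms on the tangent spaces of `M`,
is smooth on `J × M`. -/
def SmoothTensorOn [IsManifold (𝓡 n) ∞ M] (J : Set ℝ) (A : ℝ → TwoTensor n M) : Prop :=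
  ContMDiffOn (𝓘(ℝ, ℝ).prod (𝓡 n))
    ((𝓡 n).prod 𝓘(ℝ, EuclideanSpace ℝ (Fin n) →L[ℝ] EuclideanSpace ℝ (Fin n) →L[ℝ] ℝ)) ∞
    (fun p : ℝ × M => TotalSpace.mk'
      (EuclideanSpace ℝ (Fin n) →L[ℝ] EuclideanSpace ℝ (Fin n) →L[ℝ] ℝ)
      (E := fun x : M => TangentSpace (𝓡 n) x →L[ℝ] TangentSpace (𝓡 n) x →L[ℝ] ℝ)
      p.2 (A p.1 p.2)) (J ×ˢ univ)

end Manifold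

end EvolvingMetric

end

open EvolvingMetric

/-! Since `u = (4πτ)^(-n/2) e^(-f)`, one has `∇u = -u ∇f`, and `□* u = 0` amounts to `∂f/∂t = -Δf +
|∇f|² - S + n/(2τ)`. For `v = P u` this gives `□* v = -u (∂P/∂t + ΔP - 2⟨∇P, ∇f⟩)`. Expanding
`∂P/∂t` brings in the effect of the moving metric: `[∂_t, Δ] f = 2⟨α, ∇∇f⟩ + ⟨2 Div α - ∇S, ∇f⟩`
(`E_lap`) and `∂_t |∇f|² = 2α(∇f, ∇f) + 2⟨∇(∂_t f), ∇f⟩` (`E_bracket_self`). The terms `ΔΔf` cancel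
and one `Δ|∇f|²` is left, which Bochner's formula (`lap_bracket_self`) converts into `|∇∇f|²`, a
Ricci term and a term that cancels. The rest is the square of `inner_soliton` together with
`mueller`; the balance is struck in `conjHeat_entropyDensity`.

All of this is algebra: it uses only commuting derivations of a commutative ring and a symmetric
invertible matrix (`AlgMetric`). The ring is then taken to be the smooth functions on `[0, T)` times
a chart image (`smoothRing`), with the spatial partial derivatives and the time derivative as
derivations; `Represents` and evaluation at points translate the identity back.

The translation requires chart independence. Geometric quantities at a point are defined through the
preferred chart of that point, whereas differentiating them calls for one chart on a neighbourhood.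
For the trace this is linear algebra (`traceOf_eq`). For the Laplacian, `two_mul_hess` expresses the
Hessian through inner products of gradients, which are defined without coordinates
(`laplaceBeltrami_eq`). -/

section

open Matrix

noncomputable section

/-! ### Leibniz rules for matrices and vectors. -/

/-- Entrywise application of a derivation to a matrix obeys the Leibniz rule. -/
theorem Derivation.map_matrix_mul {R l m o : Type*} [Fintype m] [CommRing R] [Algebra ℝ R]
    (D : Derivation ℝ R R) (A : Matrix l m R) (B : Matrix m o R) :
    (A * B).map D = A.map D * B + A * B.map D := by
  ext i j
  simp only [Matrix.map_apply, Matrix.mul_apply, Matrix.add_apply, map_sum, Derivation.leibniz,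
    smul_eq_mul, Finset.sum_add_distrib]
  rw [add_comm]
  congr 1
  exact Finset.sum_congr rfl fun _ _ => mul_comm _ _

theorem Derivation.map_mulVec {R l m : Type*} [Fintype m] [CommRing R] [Algebra ℝ R]
    (D : Derivation ℝ R R) (A : Matrix l m R) (b : m → R) :
    (fun i => D ((A *ᵥ b) i)) = A.map D *ᵥ b + A *ᵥ (fun i => D (b i)) := by
  ext i
  simp only [Matrix.map_apply, Matrix.mulVec, dotProduct, Pi.add_apply, map_sum,
    Derivation.leibniz, smul_eq_mul, Finset.sum_add_distrib]
  rw [add_comm]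
  congr 1
  exact Finset.sum_congr rfl fun _ _ => mul_comm _ _

theorem Derivation.map_dotProduct {R m : Type*} [Fintype m] [CommRing R] [Algebra ℝ R]
    (D : Derivation ℝ R R) (a b : m → R) :
    D (a ⬝ᵥ b) = (fun i => D (a i)) ⬝ᵥ b + a ⬝ᵥ (fun i => D (b i)) := by
  simp only [dotProduct, map_sum, Derivation.leibniz, smul_eq_mul, Finset.sum_add_distrib]
  rw [add_comm]
  congr 1
  exact Finset.sum_congr rfl fun _ _ => mul_comm _ _

/-! ### Levi-Civita connection, curvature and Hessian over a ring with derivations. -/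

/-- A metric with Gram matrix `G` over a commutative ring with commuting derivations `D i`,
with inverse Gram matrix `H`: the algebraic skeleton of a Riemannian metric in a chart. -/
structure AlgMetric (ι R : Type*) [Fintype ι] [DecidableEq ι] [CommRing R] [Algebra ℝ R] where
  D : ι → Derivation ℝ R R
  D_comm : ∀ i j F, D i (D j F) = D j (D i F)
  G : Matrix ι ι R
  H : Matrix ι ι R
  G_symm : Gᵀ = G
  G_mul_H : G * H = 1

namespace AlgMetric

variable {ι R : Type*} [Fintype ι] [DecidableEq ι] [CommRing R] [Algebra ℝ R] (𝔤 : AlgMetric ι R)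

theorem H_mul_G : 𝔤.H * 𝔤.G = 1 := mul_eq_one_comm.mp 𝔤.G_mul_H

theorem H_symm : 𝔤.Hᵀ = 𝔤.H := by
  have h : 𝔤.Hᵀ * 𝔤.G = 1 := by
    have := congrArg Matrix.transpose 𝔤.G_mul_H
    rwa [Matrix.transpose_mul, 𝔤.G_symm, Matrix.transpose_one] at this
  calc 𝔤.Hᵀ = 𝔤.Hᵀ * (𝔤.G * 𝔤.H) := by rw [𝔤.G_mul_H, mul_one]
    _ = 𝔤.H := by rw [← mul_assoc, h, one_mul]

theorem H_apply_comm (i j : ι) : 𝔤.H i j = 𝔤.H j i := congrFun (congrFun 𝔤.H_symm j) i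

theorem G_apply_comm (i j : ι) : 𝔤.G i j = 𝔤.G j i := congrFun (congrFun 𝔤.G_symm j) i

/-- The connection matrices: `Γ k l i` is the Christoffel symbol `Γ^l_ki`. -/
def Γ (k : ι) : Matrix ι ι R := Matrix.of fun l i =>
  algebraMap ℝ R (1 / 2) * ∑ m, 𝔤.H l m *
    (𝔤.D k (𝔤.G i m) + 𝔤.D i (𝔤.G k m) - 𝔤.D m (𝔤.G k i))

theorem Γ_comm (k l i : ι) : 𝔤.Γ k l i = 𝔤.Γ i l k := by
  simp only [Γ, Matrix.of_apply]
  congr 1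
  refine Finset.sum_congr rfl fun m _ => ?_
  rw [𝔤.G_apply_comm k i]
  ring

/-- The scalar `1 / 2` lives in `R` only through `algebraMap`; this is the one relation about it
that the computations need. -/
theorem half_add_half (x : R) : algebraMap ℝ R (1 / 2) * x + algebraMap ℝ R (1 / 2) * x = x := by
  rw [← add_mul, ← map_add]
  norm_num

/-- Lowering the index cancels `H` and leaves the Christoffel symbols of the first kind, whose
symmetrization is metric compatibility. -/
theorem G_mul_Γ (k a i : ι) : (𝔤.G * 𝔤.Γ k) a i = algebraMap ℝ R (1 / 2) *
    (𝔤.D k (𝔤.G i a) + 𝔤.D i (𝔤.G k a) - 𝔤.D a (𝔤.G k i)) := by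
  have h : 𝔤.Γ k = algebraMap ℝ R (1 / 2) • (𝔤.H * Matrix.of fun m i =>
      (𝔤.D k (𝔤.G i m) + 𝔤.D i (𝔤.G k m) - 𝔤.D m (𝔤.G k i))) := by
    ext l i
    simp [Γ, Matrix.mul_apply]
  rw [h, Matrix.mul_smul, ← mul_assoc, 𝔤.G_mul_H, one_mul]
  simp

/-- Metric compatibility of the connection. -/
theorem map_D_G (k : ι) : 𝔤.G.map (𝔤.D k) = (𝔤.Γ k)ᵀ * 𝔤.G + 𝔤.G * 𝔤.Γ k := by
  have h : (𝔤.Γ k)ᵀ * 𝔤.G = (𝔤.G * 𝔤.Γ k)ᵀ := by rw [Matrix.transpose_mul, 𝔤.G_symm]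
  ext i j
  rw [h, Matrix.add_apply, Matrix.transpose_apply, G_mul_Γ, G_mul_Γ, Matrix.map_apply,
    𝔤.G_apply_comm j i]
  conv_lhs => rw [← half_add_half (𝔤.D k (𝔤.G i j))]
  ring

/-- Differentiate `H * G = 1`. The derivation is arbitrary, so that the rule serves both the spatial
`D k` and the time derivative. -/
theorem map_mul_H (E : Derivation ℝ R R) :
    𝔤.H.map E = -(𝔤.H * 𝔤.G.map E * 𝔤.H) := by
  have h := E.map_matrix_mul 𝔤.H 𝔤.G
  have h0 : (1 : Matrix ι ι R).map E = 0 := by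
    ext i j
    by_cases hij : i = j <;> simp [hij]
  rw [H_mul_G, h0] at h
  have h1 : 𝔤.H.map E * 𝔤.G = -(𝔤.H * 𝔤.G.map E) := eq_neg_of_add_eq_zero_left h.symm
  calc 𝔤.H.map E = 𝔤.H.map E * (𝔤.G * 𝔤.H) := by rw [𝔤.G_mul_H, mul_one]
    _ = _ := by rw [← mul_assoc, h1, Matrix.neg_mul]

theorem map_D_H (k : ι) : 𝔤.H.map (𝔤.D k) = -(𝔤.Γ k * 𝔤.H + 𝔤.H * (𝔤.Γ k)ᵀ) := by
  rw [map_mul_H, map_D_G, mul_add, add_mul]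
  rw [← mul_assoc 𝔤.H 𝔤.G, 𝔤.H_mul_G, one_mul, mul_assoc, mul_assoc, 𝔤.G_mul_H, mul_one, add_comm]

/-- The curvature matrices `R_li = ∂_l Γ_i - ∂_i Γ_l + [Γ_l, Γ_i]`. -/
def curv (l i : ι) : Matrix ι ι R :=
  (𝔤.Γ i).map (𝔤.D l) - (𝔤.Γ l).map (𝔤.D i) + 𝔤.Γ l * 𝔤.Γ i - 𝔤.Γ i * 𝔤.Γ l

theorem map_D_D_H (l i : ι) : (𝔤.H.map (𝔤.D i)).map (𝔤.D l) =
    -((𝔤.Γ i).map (𝔤.D l) * 𝔤.H - 𝔤.Γ i * (𝔤.Γ l * 𝔤.H + 𝔤.H * (𝔤.Γ l)ᵀ)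
      - (𝔤.Γ l * 𝔤.H + 𝔤.H * (𝔤.Γ l)ᵀ) * (𝔤.Γ i)ᵀ + 𝔤.H * ((𝔤.Γ i).map (𝔤.D l))ᵀ) := by
  have h : ∀ A B : Matrix ι ι R, (-(A + B)).map (𝔤.D l) = -(A.map (𝔤.D l) + B.map (𝔤.D l)) := by
    intro A B; ext; simp
  rw [map_D_H, h, Derivation.map_matrix_mul, Derivation.map_matrix_mul, map_D_H,
    Matrix.transpose_map]
  noncomm_ring

/-- Skew-symmetry of the curvature in its matrix indices. The second derivatives of `H` commute;
inserting `map_D_D_H` on both sides, the terms symmetric in `l` and `i` drop out and exactly the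
curvature terms survive. -/
theorem curv_mul_H (l i : ι) : 𝔤.curv l i * 𝔤.H = -(𝔤.H * (𝔤.curv l i)ᵀ) := by
  have h : (𝔤.H.map (𝔤.D i)).map (𝔤.D l) = (𝔤.H.map (𝔤.D l)).map (𝔤.D i) := by
    ext a b
    exact 𝔤.D_comm l i _
  rw [map_D_D_H, map_D_D_H] at h
  rw [eq_neg_iff_add_eq_zero]
  rw [neg_inj, ← sub_eq_zero] at h
  rw [← h, curv]
  simp only [Matrix.transpose_add, Matrix.transpose_sub, Matrix.transpose_mul]
  noncomm_ring

/-- The Ricci tensor `R_jk = R^i_ijk`. -/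
def ricci : Matrix ι ι R := Matrix.of fun j k => ∑ i, 𝔤.curv i j i k

/-- The differential of `F`. -/
def d (F : R) : ι → R := fun i => 𝔤.D i F

/-- The gradient of `F`. -/
def grad (F : R) : ι → R := 𝔤.H *ᵥ 𝔤.d F

/-- The inner product of gradients. -/
def bracket (a b : R) : R := 𝔤.d a ⬝ᵥ 𝔤.grad b

/-- The Hessian of `F`. -/
def hess (F : R) : Matrix ι ι R :=
  Matrix.of fun i j => 𝔤.D i (𝔤.D j F) - ∑ k, 𝔤.Γ i k j * 𝔤.D k F

/-- The covariant derivative of a 2-tensor. -/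
def cov (k : ι) (A : Matrix ι ι R) : Matrix ι ι R :=
  A.map (𝔤.D k) - (𝔤.Γ k)ᵀ * A - A * 𝔤.Γ k

/-- The metric trace of a 2-tensor. -/
def tr (A : Matrix ι ι R) : R := ∑ i, ∑ j, 𝔤.H i j * A i j

/-- The inner product of 2-tensors. -/
def inner (A B : Matrix ι ι R) : R := ∑ i, ∑ j, ∑ k, ∑ l, 𝔤.H i k * 𝔤.H j l * A i j * B k l

/-- The Laplacian. -/
def lap (F : R) : R := 𝔤.tr (𝔤.hess F)

/-- The divergence of a 2-tensor. -/
def div (A : Matrix ι ι R) (k : ι) : R := ∑ i, ∑ j, 𝔤.H i j * 𝔤.cov i A j k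

/-- Passing from index sums to matrix traces lets cyclicity of the trace replace reindexing; the
symmetry of `A` absorbs a transposition. -/
theorem tr_eq_trace {A : Matrix ι ι R} (hA : Aᵀ = A) : 𝔤.tr A = (𝔤.H * A).trace := by
  simp only [tr, Matrix.trace, Matrix.diag, Matrix.mul_apply]
  refine Finset.sum_congr rfl fun i _ => Finset.sum_congr rfl fun j _ => ?_
  rw [← congrFun (congrFun hA i) j, Matrix.transpose_apply]

theorem inner_eq_trace {A : Matrix ι ι R} (B : Matrix ι ι R) (hA : Aᵀ = A) :
    𝔤.inner A B = (A * 𝔤.H * B * 𝔤.H).trace := by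
  have h : (A * 𝔤.H * B * 𝔤.H) = (Aᵀ * 𝔤.H * B * 𝔤.H) := by rw [hA]
  rw [h]
  simp only [inner, Matrix.trace, Matrix.diag, Matrix.mul_apply, Finset.sum_mul,
    Matrix.transpose_apply]
  rw [Finset.sum_comm]
  refine Finset.sum_congr rfl fun j _ => ?_
  rw [Finset.sum_comm, Finset.sum_comm' (t' := Finset.univ) (s' := fun _ => Finset.univ) (by simp)]
  conv_rhs => rw [Finset.sum_comm]
  conv_rhs => enter [2, k]; rw [Finset.sum_comm]
  rw [Finset.sum_comm]
  refine Finset.sum_congr rfl fun k _ => Finset.sum_congr rfl fun i _ =>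
    Finset.sum_congr rfl fun l _ => ?_
  rw [𝔤.H_apply_comm j l]
  ring

theorem hess_symm (F : R) : (𝔤.hess F)ᵀ = 𝔤.hess F := by
  ext i j
  simp only [hess, Matrix.transpose_apply, Matrix.of_apply]
  rw [𝔤.D_comm j i]
  simp only [𝔤.Γ_comm j _ i]

theorem D_d (k : ι) (F : R) :
    (fun i => 𝔤.D k (𝔤.d F i)) = 𝔤.hess F k + (𝔤.Γ k)ᵀ *ᵥ 𝔤.d F := by
  ext i
  simp [hess, d, Matrix.mulVec, dotProduct]

/-- Raising an index commutes with covariant differentiation: the `Γᵀ` terms of `D_d` and of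
`map_D_H` cancel. -/
theorem D_grad (k : ι) (F : R) :
    (fun i => 𝔤.D k (𝔤.grad F i)) = 𝔤.H *ᵥ 𝔤.hess F k - 𝔤.Γ k *ᵥ 𝔤.grad F := by
  unfold grad
  rw [Derivation.map_mulVec, D_d, map_D_H, Matrix.neg_mulVec, Matrix.add_mulVec, Matrix.mulVec_add]
  simp only [Matrix.mulVec_mulVec]
  abel

theorem bracket_comm (a b : R) : 𝔤.bracket a b = 𝔤.bracket b a := by
  rw [bracket, grad, bracket, grad, Matrix.dotProduct_mulVec, dotProduct_comm,
    ← Matrix.mulVec_transpose, H_symm]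

theorem D_bracket (k : ι) (a b : R) :
    𝔤.D k (𝔤.bracket a b) = 𝔤.hess a k ⬝ᵥ 𝔤.grad b + 𝔤.hess b k ⬝ᵥ 𝔤.grad a := by
  have h : 𝔤.d a ⬝ᵥ (𝔤.H *ᵥ 𝔤.hess b k) = 𝔤.hess b k ⬝ᵥ 𝔤.grad a := by
    rw [grad, Matrix.dotProduct_mulVec, dotProduct_comm, ← Matrix.mulVec_transpose, H_symm]
  have h' : (𝔤.Γ k)ᵀ *ᵥ 𝔤.d a ⬝ᵥ 𝔤.grad b = 𝔤.d a ⬝ᵥ (𝔤.Γ k *ᵥ 𝔤.grad b) := by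
    rw [Matrix.dotProduct_mulVec, Matrix.mulVec_transpose]
  rw [bracket, Derivation.map_dotProduct, D_d, D_grad, add_dotProduct, dotProduct_sub, h, h']
  ring

theorem d_bracket (a b : R) :
    𝔤.d (𝔤.bracket a b) = 𝔤.hess a *ᵥ 𝔤.grad b + 𝔤.hess b *ᵥ 𝔤.grad a := by
  ext k
  exact 𝔤.D_bracket k a b

/-- Koszul-type formula: the Hessian is determined by the inner products of gradients. -/
theorem two_mul_hess (f a b : R) : 2 * (𝔤.grad a ⬝ᵥ (𝔤.hess f *ᵥ 𝔤.grad b)) =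
    𝔤.bracket b (𝔤.bracket f a) + 𝔤.bracket a (𝔤.bracket f b) - 𝔤.bracket f (𝔤.bracket a b) := by
  have h : ∀ a b c : R, 𝔤.bracket a (𝔤.bracket b c) = 𝔤.d (𝔤.bracket b c) ⬝ᵥ 𝔤.grad a :=
    fun a b c => by rw [𝔤.bracket_comm]; rfl
  have hs : ∀ a b c : R, (𝔤.hess a *ᵥ 𝔤.grad b) ⬝ᵥ 𝔤.grad c
      = 𝔤.grad b ⬝ᵥ (𝔤.hess a *ᵥ 𝔤.grad c) := fun a b c => by
    rw [Matrix.dotProduct_mulVec, ← Matrix.mulVec_transpose, hess_symm]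
  have hs' : ∀ a b c : R, 𝔤.grad b ⬝ᵥ (𝔤.hess a *ᵥ 𝔤.grad c)
      = 𝔤.grad c ⬝ᵥ (𝔤.hess a *ᵥ 𝔤.grad b) := fun a b c => by
    rw [← hs, dotProduct_comm]
  rw [h, h, h, d_bracket, d_bracket, d_bracket]
  simp only [add_dotProduct, hs]
  rw [hs' a b f, hs' b a f, hs' f b a]
  ring

/-- The metric is parallel, so the connection terms of `map_D_H` and of `cov` cancel under the
trace. -/
theorem D_tr (k : ι) {A : Matrix ι ι R} (hA : Aᵀ = A) :
    𝔤.D k (𝔤.tr A) = 𝔤.tr (𝔤.cov k A) := by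
  have hA' : (A.map (𝔤.D k))ᵀ = A.map (𝔤.D k) := by rw [← Matrix.transpose_map, hA]
  have hc : (𝔤.cov k A)ᵀ = 𝔤.cov k A := by
    simp only [cov, Matrix.transpose_sub, Matrix.transpose_mul, hA', hA, Matrix.transpose_transpose]
    abel
  have hD : 𝔤.D k ((𝔤.H * A).trace) = ((𝔤.H * A).map (𝔤.D k)).trace := by
    simp [Matrix.trace]
  rw [tr_eq_trace _ hA, tr_eq_trace _ hc, hD, Derivation.map_matrix_mul, map_D_H, cov, neg_mul,
    add_mul, mul_sub, mul_sub]
  simp only [Matrix.trace_add, Matrix.trace_sub, Matrix.trace_neg]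
  rw [mul_assoc, Matrix.trace_mul_comm (𝔤.Γ k)]
  simp only [mul_assoc]
  ring

/-- The Ricci identity for the third covariant derivatives of a function. -/
theorem cov_hess_sub (F : R) (l i k : ι) : 𝔤.cov l (𝔤.hess F) i k - 𝔤.cov i (𝔤.hess F) l k
    = -∑ m, 𝔤.curv l i m k * 𝔤.D m F := by
  -- The full expansion of the third derivative. Antisymmetrizing in `l` and `i` removes `D l (D i
  -- _)` by commutation, the `Γ l m i` term by vanishing torsion, and the two mixed `Γᵀ *ᵥ hess`
  -- terms against each other; only curvature remains.
  have h : ∀ l i, (fun k => 𝔤.cov l (𝔤.hess F) i k) = (fun k => 𝔤.D l (𝔤.D i (𝔤.d F k)))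
      - ((𝔤.Γ i).map (𝔤.D l))ᵀ *ᵥ 𝔤.d F - (𝔤.Γ i)ᵀ *ᵥ (𝔤.hess F l + (𝔤.Γ l)ᵀ *ᵥ 𝔤.d F)
      - (∑ m, 𝔤.Γ l m i • 𝔤.hess F m) - (𝔤.Γ l)ᵀ *ᵥ 𝔤.hess F i := by
    intro l i
    have e : 𝔤.hess F i = (fun k => 𝔤.D i (𝔤.d F k)) - (𝔤.Γ i)ᵀ *ᵥ 𝔤.d F := by
      rw [D_d, add_sub_cancel_right]
    have e' : (fun k => 𝔤.D l (𝔤.hess F i k)) = (fun k => 𝔤.D l (𝔤.D i (𝔤.d F k)))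
        - (((𝔤.Γ i).map (𝔤.D l))ᵀ *ᵥ 𝔤.d F + (𝔤.Γ i)ᵀ *ᵥ (𝔤.hess F l + (𝔤.Γ l)ᵀ *ᵥ 𝔤.d F)) := by
      rw [← D_d, ← Matrix.transpose_map, ← Derivation.map_mulVec]
      ext k
      rw [e]
      simp
    rw [sub_sub _ _ ((𝔤.Γ i)ᵀ *ᵥ _), ← e']
    ext k
    simp [cov, Matrix.mul_apply, Matrix.mulVec, dotProduct, mul_comm]
  have hs : (∑ m, 𝔤.Γ l m i • 𝔤.hess F m) = ∑ m, 𝔤.Γ i m l • 𝔤.hess F m := by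
    simp only [𝔤.Γ_comm l]
  have hc : (fun k => 𝔤.D l (𝔤.D i (𝔤.d F k))) = (fun k => 𝔤.D i (𝔤.D l (𝔤.d F k))) := by
    ext k; exact 𝔤.D_comm _ _ _
  have key : (fun k => 𝔤.cov l (𝔤.hess F) i k) - (fun k => 𝔤.cov i (𝔤.hess F) l k)
      = -((𝔤.curv l i)ᵀ *ᵥ 𝔤.d F) := by
    rw [h, h, hs, hc, curv]
    simp only [Matrix.transpose_add, Matrix.transpose_sub, Matrix.transpose_mul,
      Matrix.add_mulVec, Matrix.sub_mulVec, ← Matrix.mulVec_mulVec, Matrix.mulVec_add]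
    abel
  have := congrFun key k
  simpa [Matrix.mulVec, dotProduct, d] using this

end AlgMetric

/-! ### Bochner's formula. -/

namespace AlgMetric

variable {ι R : Type*} [Fintype ι] [DecidableEq ι] [CommRing R] [Algebra ℝ R] (𝔤 : AlgMetric ι R)

theorem cov_symm (k : ι) {A : Matrix ι ι R} (hA : Aᵀ = A) : (𝔤.cov k A)ᵀ = 𝔤.cov k A := by
  simp only [cov, Matrix.transpose_sub, Matrix.transpose_mul, ← Matrix.transpose_map, hA,
    Matrix.transpose_transpose]
  abel

/-- Covariant product rule applied to `d|∇F|² = 2 ∇∇F(∇F)`: one term carries third derivatives, the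
other is the square of the Hessian. -/
theorem hess_bracket_self (F : R) (l : ι) : 𝔤.hess (𝔤.bracket F F) l =
    (2 : R) • (𝔤.cov l (𝔤.hess F) *ᵥ 𝔤.grad F + 𝔤.hess F *ᵥ (𝔤.H *ᵥ 𝔤.hess F l)) := by
  have h1 : 𝔤.d (𝔤.bracket F F) = (2 : R) • (𝔤.hess F *ᵥ 𝔤.grad F) := by
    rw [d_bracket, two_smul]
  have h2 : (fun k => 𝔤.D l (𝔤.d (𝔤.bracket F F) k)) = (2 : R) • ((𝔤.hess F).map (𝔤.D l) *ᵥ 𝔤.grad F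
      + 𝔤.hess F *ᵥ (𝔤.H *ᵥ 𝔤.hess F l - 𝔤.Γ l *ᵥ 𝔤.grad F)) := by
    rw [← D_grad, ← Derivation.map_mulVec, h1]
    ext k
    simp [two_mul]
  have h3 := 𝔤.D_d l (𝔤.bracket F F)
  rw [eq_comm, ← eq_sub_iff_add_eq, h2, h1] at h3
  rw [h3, cov, Matrix.mulVec_smul, ← smul_sub]
  congr 1
  simp only [Matrix.sub_mulVec, Matrix.mulVec_sub, ← Matrix.mulVec_mulVec]
  abel

/-- Bochner's formula. -/
theorem lap_bracket_self (F : R) : 𝔤.lap (𝔤.bracket F F) =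
    2 * 𝔤.inner (𝔤.hess F) (𝔤.hess F) + 2 * 𝔤.bracket F (𝔤.lap F)
      + 2 * ∑ j, ∑ k, 𝔤.ricci j k * 𝔤.grad F j * 𝔤.grad F k := by
  have h1 : 𝔤.lap (𝔤.bracket F F) = 2 * (∑ l, ∑ k, 𝔤.H l k * (𝔤.cov l (𝔤.hess F) *ᵥ 𝔤.grad F) k)
      + 2 * ∑ l, ∑ k, 𝔤.H l k * (𝔤.hess F *ᵥ (𝔤.H *ᵥ 𝔤.hess F l)) k := by
    rw [lap, tr, ← mul_add, ← Finset.sum_add_distrib, Finset.mul_sum]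
    refine Finset.sum_congr rfl fun l _ => ?_
    rw [← Finset.sum_add_distrib, Finset.mul_sum]
    refine Finset.sum_congr rfl fun k _ => ?_
    rw [hess_bracket_self]
    simp only [Pi.smul_apply, Pi.add_apply, smul_eq_mul]
    ring
  have h2 : ∑ l, ∑ k, 𝔤.H l k * (𝔤.hess F *ᵥ (𝔤.H *ᵥ 𝔤.hess F l)) k
      = 𝔤.inner (𝔤.hess F) (𝔤.hess F) := by
    have h : (𝔤.H * (𝔤.hess F * 𝔤.H * (𝔤.hess F)ᵀ)).trace
        = ∑ l, ∑ k, 𝔤.H l k * (𝔤.hess F *ᵥ (𝔤.H *ᵥ 𝔤.hess F l)) k := by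
      rw [mul_assoc (𝔤.hess F), Matrix.trace]
      simp only [Matrix.diag, Matrix.mul_apply (M := 𝔤.H) (N := 𝔤.hess F * (𝔤.H * (𝔤.hess F)ᵀ))]
      rfl
    rw [← h, 𝔤.inner_eq_trace _ (𝔤.hess_symm F), Matrix.trace_mul_comm, hess_symm]
  -- The Ricci identity moves the derivative along `∇F` to the outside, where it acts on the trace
  -- `ΔF`, at the price of a curvature term.
  have h3 : ∑ l, ∑ k, 𝔤.H l k * (𝔤.cov l (𝔤.hess F) *ᵥ 𝔤.grad F) k
      = (∑ i, 𝔤.tr (𝔤.cov i (𝔤.hess F)) * 𝔤.grad F i)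
        - ∑ l, ∑ i, ∑ m, (𝔤.curv l i * 𝔤.H) m l * 𝔤.d F m * 𝔤.grad F i := by
    have e : ∀ l k i, 𝔤.cov l (𝔤.hess F) k i = 𝔤.cov i (𝔤.hess F) l k
        - ∑ m, 𝔤.curv l i m k * 𝔤.d F m := fun l k i => by
      rw [← congrFun (congrFun (𝔤.cov_symm l (𝔤.hess_symm F)) k) i, Matrix.transpose_apply]
      have h := 𝔤.cov_hess_sub F l i k
      simp only [d]
      linear_combination h
    have e1 : (∑ i, 𝔤.tr (𝔤.cov i (𝔤.hess F)) * 𝔤.grad F i)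
        = ∑ l, ∑ k, ∑ i, 𝔤.H l k * (𝔤.cov i (𝔤.hess F) l k * 𝔤.grad F i) := by
      simp only [tr, Finset.sum_mul]
      rw [Finset.sum_comm]
      refine Finset.sum_congr rfl fun l _ => ?_
      rw [Finset.sum_comm]
      simp only [mul_assoc]
    have e2 : ∑ l, ∑ i, ∑ m, (𝔤.curv l i * 𝔤.H) m l * 𝔤.d F m * 𝔤.grad F i
        = ∑ l, ∑ k, ∑ i, 𝔤.H l k * ((∑ m, 𝔤.curv l i m k * 𝔤.d F m) * 𝔤.grad F i) := by
      refine Finset.sum_congr rfl fun l _ => ?_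
      rw [Finset.sum_comm]
      conv_rhs => rw [Finset.sum_comm]
      rw [Finset.sum_comm]
      refine Finset.sum_congr rfl fun i _ => ?_
      simp only [Matrix.mul_apply, Finset.sum_mul, Finset.mul_sum]
      rw [Finset.sum_comm]
      refine Finset.sum_congr rfl fun k _ => Finset.sum_congr rfl fun m _ => ?_
      rw [𝔤.H_apply_comm k l]
      ring
    rw [e1, e2, ← Finset.sum_sub_distrib]
    refine Finset.sum_congr rfl fun l _ => ?_
    rw [← Finset.sum_sub_distrib]
    refine Finset.sum_congr rfl fun k _ => ?_
    rw [← Finset.sum_sub_distrib, Matrix.mulVec, dotProduct, Finset.mul_sum]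
    refine Finset.sum_congr rfl fun i _ => ?_
    rw [e]
    ring
  have h4 : (∑ i, 𝔤.tr (𝔤.cov i (𝔤.hess F)) * 𝔤.grad F i) = 𝔤.bracket F (𝔤.lap F) := by
    rw [bracket_comm]
    refine Finset.sum_congr rfl fun i _ => ?_
    rw [← 𝔤.D_tr i (𝔤.hess_symm F)]
    rfl
  -- Here `l` is contracted with the last, raised index. Skewness (`curv_mul_H`) shifts the
  -- contraction to the pair that defines `ricci` and produces the sign.
  have h5 : ∑ l, ∑ i, ∑ m, (𝔤.curv l i * 𝔤.H) m l * 𝔤.d F m * 𝔤.grad F i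
      = -∑ j, ∑ k, 𝔤.ricci j k * 𝔤.grad F j * 𝔤.grad F k := by
    rw [Finset.sum_comm, ← Finset.sum_neg_distrib]
    refine Finset.sum_congr rfl fun i _ => ?_
    have e : ∀ (c : R) (l), ∑ m, (𝔤.curv l i * 𝔤.H) m l * 𝔤.d F m * c
        = ∑ k, -(𝔤.curv l i l k * c * 𝔤.grad F k) := fun c l => by
      have q : ∀ m, (𝔤.curv l i * 𝔤.H) m l = ∑ k, -(𝔤.H m k * 𝔤.curv l i l k) := fun m => by
        rw [curv_mul_H, Matrix.neg_apply, Matrix.mul_apply, Finset.sum_neg_distrib]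
        rfl
      have q' : ∀ k, 𝔤.grad F k = ∑ m, 𝔤.H k m * 𝔤.d F m := fun _ => rfl
      simp only [q, q', Finset.sum_mul, Finset.mul_sum, ← Finset.sum_neg_distrib]
      rw [Finset.sum_comm]
      refine Finset.sum_congr rfl fun k _ => ?_
      refine Finset.sum_congr rfl fun m _ => ?_
      rw [𝔤.H_apply_comm k m]
      ring
    simp only [e]
    rw [Finset.sum_comm, ← Finset.sum_neg_distrib]
    refine Finset.sum_congr rfl fun k _ => ?_
    simp only [ricci, Matrix.of_apply, Finset.sum_mul, Finset.sum_neg_distrib]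
  rw [h1, h2, h3, h4, h5]
  ring

/-! ### Elementary rules -/

theorem lap_eq (F : R) : 𝔤.lap F = ∑ i, ∑ j, 𝔤.H i j * 𝔤.hess F i j := rfl

theorem hess_apply (F : R) (i j : ι) :
    𝔤.hess F i j = 𝔤.D i (𝔤.D j F) - ∑ k, 𝔤.Γ i k j * 𝔤.D k F := rfl

theorem d_add (a b : R) : 𝔤.d (a + b) = 𝔤.d a + 𝔤.d b := by ext i; simp [d]

theorem d_mul (a b : R) : 𝔤.d (a * b) = a • 𝔤.d b + b • 𝔤.d a := by ext i; simp [d]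

theorem bracket_add_left (a b c : R) : 𝔤.bracket (a + b) c = 𝔤.bracket a c + 𝔤.bracket b c := by
  simp [bracket, d_add, add_dotProduct]

theorem bracket_mul_left (a b c : R) :
    𝔤.bracket (a * b) c = a * 𝔤.bracket b c + b * 𝔤.bracket a c := by
  simp [bracket, d_mul, add_dotProduct, smul_dotProduct]

/-- Constancy is meant in space only: scalars depending on time, such as `τ` and `σ` below, qualify.
-/
theorem bracket_of_const {a : R} (ha : ∀ i, 𝔤.D i a = 0) (b : R) : 𝔤.bracket a b = 0 := by
  simp [bracket, d, ha, dotProduct]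

theorem lap_add (a b : R) : 𝔤.lap (a + b) = 𝔤.lap a + 𝔤.lap b := by
  simp only [lap_eq, ← Finset.sum_add_distrib, ← mul_add]
  refine Finset.sum_congr rfl fun i _ => Finset.sum_congr rfl fun j _ => ?_
  simp only [hess_apply, map_add, mul_add, Finset.sum_add_distrib]
  ring

theorem lap_of_const {a : R} (ha : ∀ i, 𝔤.D i a = 0) : 𝔤.lap a = 0 := by
  simp [lap_eq, hess_apply, ha]

theorem hess_mul (a b : R) (i j : ι) : 𝔤.hess (a * b) i j =
    a * 𝔤.hess b i j + b * 𝔤.hess a i j + 𝔤.d a i * 𝔤.d b j + 𝔤.d a j * 𝔤.d b i := by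
  simp only [hess_apply, d, Derivation.leibniz, smul_eq_mul, map_add, mul_add,
    Finset.sum_add_distrib, mul_sub, Finset.mul_sum]
  have e : ∀ a b : R, ∑ k, 𝔤.Γ i k j * (a * 𝔤.D k b) = ∑ k, a * (𝔤.Γ i k j * 𝔤.D k b) :=
    fun a b => Finset.sum_congr rfl fun k _ => by ring
  rw [e, e]
  ring

theorem sum_H_mul_d (a b : R) : ∑ i, ∑ j, 𝔤.H i j * (𝔤.d a i * 𝔤.d b j) = 𝔤.bracket a b := by
  simp only [bracket, grad, Matrix.mulVec, dotProduct, Finset.mul_sum]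
  exact Finset.sum_congr rfl fun i _ => Finset.sum_congr rfl fun j _ => by ring

theorem lap_mul (a b : R) : 𝔤.lap (a * b) = a * 𝔤.lap b + b * 𝔤.lap a + 2 * 𝔤.bracket a b := by
  have h : 2 * 𝔤.bracket a b = ∑ i, ∑ j, 𝔤.H i j * (𝔤.d a i * 𝔤.d b j)
      + ∑ i, ∑ j, 𝔤.H i j * (𝔤.d b i * 𝔤.d a j) := by
    rw [sum_H_mul_d, sum_H_mul_d, 𝔤.bracket_comm b a, two_mul]
  rw [h, lap_eq, lap_eq, lap_eq]
  simp only [Finset.mul_sum, ← Finset.sum_add_distrib]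
  refine Finset.sum_congr rfl fun i _ => Finset.sum_congr rfl fun j _ => ?_
  rw [hess_mul]
  ring

/-! ### Variation of the metric -/

section Variation

variable {E : Derivation ℝ R R} {A : Matrix ι ι R}

theorem map_E_H (hG : 𝔤.G.map E = -(2 : R) • A) : 𝔤.H.map E = (2 : R) • (𝔤.H * A * 𝔤.H) := by
  rw [map_mul_H, hG]
  simp

/-- First variation of the trace of the connection. -/
theorem sum_map_E_Γ (hA : Aᵀ = A) (hE : ∀ i F, E (𝔤.D i F) = 𝔤.D i (E F))
    (hG : 𝔤.G.map E = -(2 : R) • A) (F : R) :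
    ∑ i, ∑ j, 𝔤.H i j * ∑ k, E (𝔤.Γ i k j) * 𝔤.d F k
      = 𝔤.bracket (𝔤.tr A) F - 2 * ∑ k, 𝔤.div A k * 𝔤.grad F k := by
  -- The variation of the connection with its upper index lowered. As in the Koszul formula it is
  -- pinned down by two facts: symmetry in the connection indices (`hYs`), and symmetrization equal
  -- to `-2 ∇A` (`hYt`), which is the time derivative of metric compatibility.
  set Y : ι → Matrix ι ι R := fun k => 𝔤.G * (𝔤.Γ k).map E with hY
  have hYs : ∀ k a i, Y k a i = Y i a k := fun k a i => by
    simp only [hY, Matrix.mul_apply, Matrix.map_apply, 𝔤.Γ_comm k]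
  have hYt : ∀ k, Y k + (Y k)ᵀ = -(2 : R) • 𝔤.cov k A := by
    intro k
    have h1 : (𝔤.G.map (𝔤.D k)).map E = (𝔤.G.map E).map (𝔤.D k) := by
      ext i j; exact hE _ _
    have h2 : ((-(2 : R)) • A).map (𝔤.D k) = (-(2 : R)) • A.map (𝔤.D k) := by
      ext i j; simp [two_mul]
    have h3 : ∀ A B : Matrix ι ι R, (A + B).map E = A.map E + B.map E := by
      intro A B; ext; simp
    rw [map_D_G, h3, Derivation.map_matrix_mul, Derivation.map_matrix_mul, hG, h2,
      Matrix.transpose_map] at h1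
    have h4 : (Y k)ᵀ = ((𝔤.Γ k).map E)ᵀ * 𝔤.G := by
      rw [hY, Matrix.transpose_mul, 𝔤.G_symm]
    rw [h4, cov, smul_sub, smul_sub, ← h1]
    simp only [hY, Matrix.mul_smul, Matrix.smul_mul]
    abel
  have hYt' : ∀ k a i, Y k a i + Y k i a = -(2 * 𝔤.cov k A a i) := fun k a i => by
    have := congrFun (congrFun (hYt k) a) i
    simpa using this
  have hGY : ∀ k, (𝔤.Γ k).map E = 𝔤.H * Y k := fun k => by
    rw [hY, ← mul_assoc, 𝔤.H_mul_G, one_mul]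
  have h1 : ∑ i, ∑ j, 𝔤.H i j * ∑ k, E (𝔤.Γ i k j) * 𝔤.d F k
      = ∑ a, 𝔤.grad F a * ∑ i, ∑ j, 𝔤.H i j * Y i a j := by
    have e : ∀ i j, ∑ k, E (𝔤.Γ i k j) * 𝔤.d F k = ∑ a, 𝔤.grad F a * Y i a j := fun i j => by
      have : ∀ k, E (𝔤.Γ i k j) = ∑ a, 𝔤.H k a * Y i a j := fun k => by
        rw [← Matrix.mul_apply, ← hGY]; rfl
      simp only [this, grad, Matrix.mulVec, dotProduct, Finset.sum_mul]
      rw [Finset.sum_comm]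
      refine Finset.sum_congr rfl fun a _ => Finset.sum_congr rfl fun k _ => ?_
      rw [𝔤.H_apply_comm k a]
      ring
    simp only [e, Finset.mul_sum]
    conv_rhs => rw [Finset.sum_comm]
    refine Finset.sum_congr rfl fun i _ => ?_
    rw [Finset.sum_comm]
    exact Finset.sum_congr rfl fun a _ => Finset.sum_congr rfl fun j _ => by ring
  -- The trace not wanted is computed first: by `hYs` it is a trace of `Y a`, so only the symmetric
  -- part of `Y a` contributes. The wanted trace `h3` then follows from `hYt'`, since the two add up
  -- to a divergence.
  have h2 : ∀ a, ∑ i, ∑ j, 𝔤.H i j * Y i j a = -𝔤.D a (𝔤.tr A) := by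
    intro a
    have e1 : ∑ i, ∑ j, 𝔤.H i j * Y i j a = ∑ i, ∑ j, 𝔤.H i j * Y a i j := by
      rw [Finset.sum_comm]
      refine Finset.sum_congr rfl fun i _ => Finset.sum_congr rfl fun j _ => ?_
      rw [𝔤.H_apply_comm j i, hYs]
    have e2 : ∑ i, ∑ j, 𝔤.H i j * Y a i j = ∑ i, ∑ j, 𝔤.H i j * Y a j i := by
      rw [Finset.sum_comm]
      refine Finset.sum_congr rfl fun i _ => Finset.sum_congr rfl fun j _ => ?_
      rw [𝔤.H_apply_comm j i]
    have e3 : ∑ i, ∑ j, 𝔤.H i j * Y a i j + ∑ i, ∑ j, 𝔤.H i j * Y a j i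
        = -(𝔤.D a (𝔤.tr A) + 𝔤.D a (𝔤.tr A)) := by
      rw [𝔤.D_tr a hA, tr]
      simp only [← Finset.sum_add_distrib, ← mul_add, hYt', ← Finset.sum_neg_distrib]
      exact Finset.sum_congr rfl fun a _ => Finset.sum_congr rfl fun j _ => by ring
    rw [← e2] at e3
    rw [e1, ← half_add_half (∑ i, ∑ j, 𝔤.H i j * Y a i j), ← mul_add, e3,
      mul_neg, mul_add, half_add_half]
  have h3 : ∀ a, ∑ i, ∑ j, 𝔤.H i j * Y i a j = 𝔤.D a (𝔤.tr A) - 2 * 𝔤.div A a := by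
    intro a
    have e : ∑ i, ∑ j, 𝔤.H i j * Y i a j + ∑ i, ∑ j, 𝔤.H i j * Y i j a = -(2 * 𝔤.div A a) := by
      rw [div, Finset.mul_sum, ← Finset.sum_neg_distrib, ← Finset.sum_add_distrib]
      refine Finset.sum_congr rfl fun i _ => ?_
      rw [Finset.mul_sum, ← Finset.sum_neg_distrib, ← Finset.sum_add_distrib]
      refine Finset.sum_congr rfl fun j _ => ?_
      rw [← mul_add, add_comm, hYt']
      ring
    rw [h2] at e
    linear_combination e
  rw [h1, bracket, dotProduct, Finset.mul_sum, ← Finset.sum_sub_distrib]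
  refine Finset.sum_congr rfl fun a _ => ?_
  rw [h3, d]
  ring

theorem sum_map_E_H (hG : 𝔤.G.map E = -(2 : R) • A) (hA : Aᵀ = A) {B : Matrix ι ι R} (hB : Bᵀ = B) :
    ∑ i, ∑ j, E (𝔤.H i j) * B i j = 2 * 𝔤.inner A B := by
  have h : ∑ i, ∑ j, E (𝔤.H i j) * B i j = (𝔤.H.map E * Bᵀ).trace := by
    simp [Matrix.trace, Matrix.mul_apply]
  rw [h, 𝔤.map_E_H hG, 𝔤.inner_eq_trace _ hA, hB, Matrix.smul_mul, Matrix.trace_smul, smul_eq_mul,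
    Matrix.trace_mul_comm (A * 𝔤.H * B)]
  simp only [mul_assoc]

/-- First variation of the Laplacian. -/
theorem E_lap (hA : Aᵀ = A) (hE : ∀ i F, E (𝔤.D i F) = 𝔤.D i (E F))
    (hG : 𝔤.G.map E = -(2 : R) • A) (F : R) :
    E (𝔤.lap F) = 𝔤.lap (E F) + 2 * 𝔤.inner A (𝔤.hess F)
      + 2 * (∑ k, 𝔤.div A k * 𝔤.grad F k) - 𝔤.bracket (𝔤.tr A) F := by
  have h := 𝔤.sum_map_E_Γ hA hE hG F
  -- `E` commutes with the coordinate derivatives, so only `H` and `Γ` obstruct its commuting with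
  -- the Laplacian.
  have h1 : E (𝔤.lap F) = ∑ i, ∑ j, E (𝔤.H i j) * 𝔤.hess F i j
      + 𝔤.lap (E F) - ∑ i, ∑ j, 𝔤.H i j * ∑ k, E (𝔤.Γ i k j) * 𝔤.d F k := by
    simp only [lap_eq, map_sum, ← Finset.sum_add_distrib, ← Finset.sum_sub_distrib]
    refine Finset.sum_congr rfl fun i _ => Finset.sum_congr rfl fun j _ => ?_
    simp only [Derivation.leibniz, smul_eq_mul, hess_apply, map_sub, map_sum, hE, d,
      Finset.sum_add_distrib]
    have e : ∑ k, 𝔤.D k F * E (𝔤.Γ i k j) = ∑ k, E (𝔤.Γ i k j) * 𝔤.D k F :=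
      Finset.sum_congr rfl fun k _ => mul_comm _ _
    rw [e]
    ring
  rw [h1, h, 𝔤.sum_map_E_H hG hA (𝔤.hess_symm F)]
  ring

theorem E_bracket_self (hE : ∀ i F, E (𝔤.D i F) = 𝔤.D i (E F))
    (hG : 𝔤.G.map E = -(2 : R) • A) (F : R) :
    E (𝔤.bracket F F) = 2 * (∑ i, ∑ j, A i j * 𝔤.grad F i * 𝔤.grad F j)
      + 2 * 𝔤.bracket (E F) F := by
  have hd : (fun i => E (𝔤.d F i)) = 𝔤.d (E F) := by ext i; exact hE i F
  have h : 𝔤.d F ⬝ᵥ ((𝔤.H * A * 𝔤.H) *ᵥ 𝔤.d F) = ∑ i, ∑ j, A i j * 𝔤.grad F i * 𝔤.grad F j := by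
    have : 𝔤.d F ⬝ᵥ ((𝔤.H * A * 𝔤.H) *ᵥ 𝔤.d F) = 𝔤.grad F ⬝ᵥ (A *ᵥ 𝔤.grad F) := by
      rw [mul_assoc, ← Matrix.mulVec_mulVec, Matrix.dotProduct_mulVec, ← Matrix.mulVec_transpose,
        H_symm, ← Matrix.mulVec_mulVec]
      rfl
    rw [this]
    simp only [dotProduct, Matrix.mulVec, Finset.mul_sum]
    exact Finset.sum_congr rfl fun i _ => Finset.sum_congr rfl fun j _ => by ring
  have h' : 𝔤.d F ⬝ᵥ (𝔤.H *ᵥ 𝔤.d (E F)) = 𝔤.bracket (E F) F := 𝔤.bracket_comm F (E F)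
  rw [bracket, grad, Derivation.map_dotProduct, Derivation.map_mulVec, hd, 𝔤.map_E_H hG,
    dotProduct_add, Matrix.smul_mulVec, dotProduct_smul, h, h', smul_eq_mul, bracket, grad]
  ring

end Variation

end AlgMetric

/-! ### Müller's quantity and the entropy density, algebraically. -/

namespace AlgMetric

variable {ι R : Type*} [Fintype ι] [DecidableEq ι] [CommRing R] [Algebra ℝ R] (𝔤 : AlgMetric ι R)

/-- Müller's quantity for the vector `∇F`. -/
def mueller (E : Derivation ℝ R R) (A : Matrix ι ι R) (F : R) : R :=
  E (𝔤.tr A) - 𝔤.lap (𝔤.tr A) - 2 * 𝔤.inner A A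
    + 2 * (∑ i, ∑ j, (𝔤.ricci - A) i j * 𝔤.grad F i * 𝔤.grad F j)
    + (4 * (∑ k, 𝔤.div A k * 𝔤.grad F k) - 2 * 𝔤.bracket (𝔤.tr A) F)

theorem inner_add_left (A B C : Matrix ι ι R) :
    𝔤.inner (A + B) C = 𝔤.inner A C + 𝔤.inner B C := by
  simp only [inner, Matrix.add_apply, mul_add, add_mul, Finset.sum_add_distrib]

theorem inner_comm {A B : Matrix ι ι R} (hA : Aᵀ = A) (hB : Bᵀ = B) :
    𝔤.inner A B = 𝔤.inner B A := by
  rw [𝔤.inner_eq_trace _ hA, 𝔤.inner_eq_trace _ hB, mul_assoc, Matrix.trace_mul_comm, mul_assoc,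
    mul_assoc, mul_assoc]

theorem inner_smul_left (c : R) (A B : Matrix ι ι R) :
    𝔤.inner (c • A) B = c * 𝔤.inner A B := by
  simp only [inner, Matrix.smul_apply, smul_eq_mul, Finset.mul_sum]
  refine Finset.sum_congr rfl fun i _ => Finset.sum_congr rfl fun j _ =>
    Finset.sum_congr rfl fun k _ => Finset.sum_congr rfl fun l _ => by ring

theorem inner_G_left {B : Matrix ι ι R} (hB : Bᵀ = B) : 𝔤.inner 𝔤.G B = 𝔤.tr B := by
  rw [𝔤.inner_eq_trace _ 𝔤.G_symm, 𝔤.G_mul_H, one_mul, Matrix.trace_mul_comm, 𝔤.tr_eq_trace hB]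

theorem tr_G : 𝔤.tr 𝔤.G = Fintype.card ι := by
  rw [𝔤.tr_eq_trace 𝔤.G_symm, H_mul_G, Matrix.trace_one]

/-- The norm of `A + ∇∇F - σ g` expanded. -/
theorem inner_soliton {A B : Matrix ι ι R} (hA : Aᵀ = A) (hB : Bᵀ = B) (σ : R) :
    𝔤.inner (A + B - σ • 𝔤.G) (A + B - σ • 𝔤.G) = 𝔤.inner A A + 2 * 𝔤.inner A B + 𝔤.inner B B
      - 2 * σ * (𝔤.tr A + 𝔤.tr B) + σ ^ 2 * Fintype.card ι := by
  have hs : (-σ • 𝔤.G)ᵀ = -σ • 𝔤.G := by rw [Matrix.transpose_smul, 𝔤.G_symm]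
  have hC : (A + B + -σ • 𝔤.G)ᵀ = A + B + -σ • 𝔤.G := by
    rw [Matrix.transpose_add, Matrix.transpose_add, hs, hA, hB]
  rw [sub_eq_add_neg, ← neg_smul, inner_add_left, inner_add_left, inner_smul_left,
    𝔤.inner_comm hA hC, 𝔤.inner_comm hB hC, 𝔤.inner_comm 𝔤.G_symm hC]
  simp only [inner_add_left, inner_smul_left, 𝔤.inner_G_left hA, 𝔤.inner_G_left hB,
    𝔤.inner_G_left 𝔤.G_symm, tr_G]
  rw [𝔤.inner_comm hB hA, 𝔤.inner_comm hA 𝔤.G_symm, 𝔤.inner_comm hB 𝔤.G_symm, 𝔤.inner_G_left hA,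
    𝔤.inner_G_left hB]
  ring

theorem lap_const_mul {c : R} (hc : ∀ i, 𝔤.D i c = 0) (F : R) : 𝔤.lap (c * F) = c * 𝔤.lap F := by
  rw [lap_mul, 𝔤.lap_of_const hc, 𝔤.bracket_of_const hc]
  ring

theorem bracket_const_mul {c : R} (hc : ∀ i, 𝔤.D i c = 0) (F K : R) :
    𝔤.bracket (c * F) K = c * 𝔤.bracket F K := by
  rw [bracket_mul_left, 𝔤.bracket_of_const hc]
  ring

theorem lap_neg (F : R) : 𝔤.lap (-F) = -𝔤.lap F := by
  have := 𝔤.lap_const_mul (c := -1) (by simp) F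
  simpa using this

theorem bracket_neg_left (F K : R) : 𝔤.bracket (-F) K = -𝔤.bracket F K := by
  have := 𝔤.bracket_const_mul (c := -1) (by simp) F K
  simpa using this

theorem lap_sub (a b : R) : 𝔤.lap (a - b) = 𝔤.lap a - 𝔤.lap b := by
  rw [sub_eq_add_neg, lap_add, lap_neg, sub_eq_add_neg]

theorem bracket_sub_left (a b c : R) : 𝔤.bracket (a - b) c = 𝔤.bracket a c - 𝔤.bracket b c := by
  rw [sub_eq_add_neg, bracket_add_left, bracket_neg_left, sub_eq_add_neg]

variable {E : Derivation ℝ R R} {A : Matrix ι ι R} {f u τ σ : R}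

/-- The hypothesis `hu` is the only trace here of `u = c e^(-f)` with `c` constant in space. -/
theorem bracket_density (hu : ∀ i, 𝔤.D i u = -(u * 𝔤.D i f)) (P : R) :
    𝔤.bracket P u = -(u * 𝔤.bracket P f) := by
  have h : 𝔤.d u = -u • 𝔤.d f := by ext i; simp [d, hu]
  rw [bracket, grad, h, Matrix.mulVec_smul, dotProduct_smul, smul_eq_mul, neg_mul]
  rfl

theorem lap_density (hu : ∀ i, 𝔤.D i u = -(u * 𝔤.D i f)) :
    𝔤.lap u = u * (𝔤.bracket f f - 𝔤.lap f) := by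
  have h : ∀ i j, 𝔤.hess u i j = u * (𝔤.d f i * 𝔤.d f j) - u * 𝔤.hess f i j := fun i j => by
    simp only [hess_apply, hu, map_neg, Derivation.leibniz, smul_eq_mul, d, mul_sub,
      Finset.mul_sum, mul_neg, Finset.sum_neg_distrib]
    have e : ∑ k, 𝔤.Γ i k j * (u * 𝔤.D k f) = ∑ k, u * (𝔤.Γ i k j * 𝔤.D k f) :=
      Finset.sum_congr rfl fun k _ => by ring
    rw [e]
    ring
  rw [← sum_H_mul_d, lap_eq, lap_eq]
  simp only [h, Finset.mul_sum, ← Finset.sum_sub_distrib, mul_sub]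
  exact Finset.sum_congr rfl fun i _ => Finset.sum_congr rfl fun j _ => by ring

/-- The evolution equation of the entropy density. -/
theorem conjHeat_entropyDensity (hA : Aᵀ = A) (hE : ∀ i F, E (𝔤.D i F) = 𝔤.D i (E F))
    (hG : 𝔤.G.map E = -(2 : R) • A) (hu : ∀ i, 𝔤.D i u = -(u * 𝔤.D i f)) (hu0 : IsUnit u)
    (hEu : E u = u * (Fintype.card ι * σ - E f)) (hτ : ∀ i, 𝔤.D i τ = 0) (hEτ : E τ = -1)
    (hσ : ∀ i, 𝔤.D i σ = 0) (hτσ : 2 * τ * σ = 1)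
    (hheat : -E u - 𝔤.lap u + 𝔤.tr A * u = 0) {P : R}
    (hP : P = τ * (2 * 𝔤.lap f - 𝔤.bracket f f + 𝔤.tr A) + f - Fintype.card ι) :
    -E (P * u) - 𝔤.lap (P * u) + 𝔤.tr A * (P * u) =
      -2 * τ * u * 𝔤.inner (A + 𝔤.hess f - σ • 𝔤.G) (A + 𝔤.hess f - σ • 𝔤.G)
        - τ * u * 𝔤.mueller E A f := by
  set n : R := (Fintype.card ι : R) with hn
  have hnc : ∀ i, 𝔤.D i n = 0 := fun i => by simp [hn]
  have h2c : ∀ i, 𝔤.D i (2 : R) = 0 := fun i => by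
    have := (𝔤.D i).map_natCast 2
    simpa using this
  have hE2 : E (2 : R) = 0 := by
    have := E.map_natCast 2
    simpa using this
  have hEn : E n = 0 := by simp [hn]
  have hnσ : ∀ i, 𝔤.D i (n * σ) = 0 := fun i => by simp [hnc, hσ]
  -- The conjugate heat equation read as an equation for `f`. Cancelling `u` uses that it is a unit,
  -- since `R` need not be a domain.
  have hft : E f = -𝔤.lap f + 𝔤.bracket f f - 𝔤.tr A + n * σ := by
    have h : u * (E f - (-𝔤.lap f + 𝔤.bracket f f - 𝔤.tr A + n * σ)) = 0 := by
      rw [hEu, 𝔤.lap_density hu] at hheat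
      linear_combination hheat
    exact sub_eq_zero.mp (hu0.mul_right_eq_zero.mp h)
  have hlapft : 𝔤.lap (E f) = -𝔤.lap (𝔤.lap f) + 𝔤.lap (𝔤.bracket f f) - 𝔤.lap (𝔤.tr A) := by
    rw [hft, lap_add, lap_sub, lap_add, lap_neg, 𝔤.lap_of_const hnσ, add_zero]
  have hbrft : 𝔤.bracket (E f) f = -𝔤.bracket (𝔤.lap f) f + 𝔤.bracket (𝔤.bracket f f) f
      - 𝔤.bracket (𝔤.tr A) f := by
    rw [hft, bracket_add_left, bracket_sub_left, bracket_add_left, bracket_neg_left,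
      𝔤.bracket_of_const hnσ, add_zero]
  have hlapP : 𝔤.lap P = τ * (2 * 𝔤.lap (𝔤.lap f) - 𝔤.lap (𝔤.bracket f f) + 𝔤.lap (𝔤.tr A))
      + 𝔤.lap f := by
    rw [hP, lap_sub, lap_add, 𝔤.lap_const_mul hτ, lap_add, lap_sub, 𝔤.lap_const_mul h2c,
      𝔤.lap_of_const hnc, sub_zero]
  have hbrP : 𝔤.bracket P f = τ * (2 * 𝔤.bracket (𝔤.lap f) f - 𝔤.bracket (𝔤.bracket f f) f
      + 𝔤.bracket (𝔤.tr A) f) + 𝔤.bracket f f := by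
    rw [hP, bracket_sub_left, bracket_add_left, 𝔤.bracket_const_mul hτ, bracket_add_left,
      bracket_sub_left, 𝔤.bracket_const_mul h2c, 𝔤.bracket_of_const hnc, sub_zero]
  have hEP : E P = -(2 * 𝔤.lap f - 𝔤.bracket f f + 𝔤.tr A)
      + τ * (2 * E (𝔤.lap f) - E (𝔤.bracket f f) + E (𝔤.tr A)) + E f := by
    rw [hP]
    simp only [map_add, map_sub, Derivation.leibniz, smul_eq_mul, hEτ, hE2, hEn]
    ring
  -- The terms in which `P` is not differentiated add up to `P` times the conjugate heat equation of
  -- `u`.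
  have hmain : -E (P * u) - 𝔤.lap (P * u) + 𝔤.tr A * (P * u)
      = -u * (E P + 𝔤.lap P - 2 * 𝔤.bracket P f) := by
    rw [lap_mul, 𝔤.bracket_density hu, Derivation.leibniz, smul_eq_mul, smul_eq_mul]
    linear_combination P * hheat
  have hsum : ∑ i, ∑ j, (𝔤.ricci - A) i j * 𝔤.grad f i * 𝔤.grad f j
      = (∑ i, ∑ j, 𝔤.ricci i j * 𝔤.grad f i * 𝔤.grad f j)
        - ∑ i, ∑ j, A i j * 𝔤.grad f i * 𝔤.grad f j := by
    simp only [Matrix.sub_apply, sub_mul, Finset.sum_sub_distrib]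
  have hB := 𝔤.lap_bracket_self f
  rw [𝔤.bracket_comm f (𝔤.lap f)] at hB
  have htr : 𝔤.tr (𝔤.hess f) = 𝔤.lap f := rfl
  rw [hmain, hEP, 𝔤.E_lap hA hE hG, 𝔤.E_bracket_self hE hG, hlapft, hbrft, hlapP, hbrP, hft,
    𝔤.inner_soliton hA (𝔤.hess_symm f), mueller, hsum, htr]
  -- The surviving `τ Δ|∇f|²` is traded by Bochner's formula. The relation `2τσ = 1` handles the
  -- cross terms and the constant term of the square.
  linear_combination (-u * τ) * hB + (u * n * σ - 2 * u * (𝔤.tr A + 𝔤.lap f)) * hτσ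

end AlgMetric

/-! ### Smooth functions on a set -/

section SmoothRing

/-- Extension by zero of a function on a set. -/
def zeroExtend {F : Type*} {s : Set F} (φ : s → ℝ) : F → ℝ := Function.extend Subtype.val φ 0

theorem zeroExtend_apply {F : Type*} {s : Set F} (φ : s → ℝ) (x : s) : zeroExtend φ x = φ x :=
  Subtype.val_injective.extend_apply _ _ _

/-- Derivatives in the ring below are taken within `s`, so the extension by zero may be exchanged
for any function with the same values on `s`. -/
theorem eqOn_zeroExtend {F : Type*} {s : Set F} {φ : s → ℝ} {Φ : F → ℝ} (h : ∀ x : s, φ x = Φ x) :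
    EqOn (zeroExtend φ) Φ s := fun x hx => by
  rw [← h ⟨x, hx⟩, ← zeroExtend_apply φ ⟨x, hx⟩]

variable {F : Type*} [NormedAddCommGroup F] [NormedSpace ℝ F]

theorem contDiffOn_zeroExtend {s : Set F} {φ : s → ℝ} {Φ : F → ℝ} (h : ∀ x : s, φ x = Φ x)
    (hΦ : ContDiffOn ℝ ∞ Φ s) : ContDiffOn ℝ ∞ (zeroExtend φ) s :=
  hΦ.congr (eqOn_zeroExtend h)

/-- The algebra of functions on `s` that are smooth within `s`. -/
def smoothRing (s : Set F) : Subalgebra ℝ (s → ℝ) where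
  carrier := {φ | ContDiffOn ℝ ∞ (zeroExtend φ) s}
  mul_mem' {a b} ha hb := contDiffOn_zeroExtend (Φ := fun x => zeroExtend a x * zeroExtend b x)
    (fun x => by simp [zeroExtend_apply]) (ContDiffOn.mul ha hb)
  add_mem' {a b} ha hb := contDiffOn_zeroExtend (Φ := fun x => zeroExtend a x + zeroExtend b x)
    (fun x => by simp [zeroExtend_apply]) (ContDiffOn.add ha hb)
  algebraMap_mem' c := contDiffOn_zeroExtend (Φ := fun _ => c) (fun _ => rfl) contDiffOn_const

namespace smoothRing

variable {s : Set F}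

theorem contDiffOn_coe (φ : smoothRing s) : ContDiffOn ℝ ∞ (zeroExtend φ.1) s := φ.2

/-- Restriction to `s` of a function that is smooth on `s`. -/
def mk (Φ : F → ℝ) (hΦ : ContDiffOn ℝ ∞ Φ s) : smoothRing s :=
  ⟨fun x => Φ x, contDiffOn_zeroExtend (fun _ => rfl) hΦ⟩

/-- Evaluation at a point. -/
def ev (p : s) : smoothRing s →ₐ[ℝ] ℝ := (Pi.evalAlgHom ℝ (fun _ : s => ℝ) p).comp (smoothRing s).val

theorem ev_apply (p : s) (φ : smoothRing s) : ev p φ = φ.1 p := rfl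

@[simp]
theorem ev_mk (p : s) (Φ : F → ℝ) (hΦ : ContDiffOn ℝ ∞ Φ s) : ev p (mk Φ hΦ) = Φ p := rfl

theorem ext_ev {φ ψ : smoothRing s} (h : ∀ p, ev p φ = ev p ψ) : φ = ψ :=
  Subtype.ext (funext h)

theorem eqOn {φ : smoothRing s} {Φ : F → ℝ} (h : ∀ p : s, ev p φ = Φ p) :
    EqOn (zeroExtend φ.1) Φ s := eqOn_zeroExtend h

/-- Supplies the units that the algebra asks for: the Gram determinant and the density `u`. -/
theorem isUnit_of_ev_ne_zero {φ : smoothRing s} (h : ∀ p, ev p φ ≠ 0) : IsUnit φ := by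
  have h' : ∀ x ∈ s, zeroExtend φ.1 x ≠ 0 := fun x hx => by
    rw [zeroExtend_apply φ.1 ⟨x, hx⟩]; exact h ⟨x, hx⟩
  refine IsUnit.of_mul_eq_one (mk (fun x => (zeroExtend φ.1 x)⁻¹) ((contDiffOn_coe φ).inv h')) ?_
  refine ext_ev fun p => ?_
  rw [map_mul, ev_mk, zeroExtend_apply, map_one]
  exact mul_inv_cancel₀ (h p)

theorem differentiableWithinAt_coe (φ : smoothRing s) (x : s) :
    DifferentiableWithinAt ℝ (zeroExtend φ.1) s x :=
  ((contDiffOn_coe φ).differentiableOn (by simp)) x x.2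

theorem contDiffOn_fderivWithin (hs : UniqueDiffOn ℝ s) (φ : smoothRing s) :
    ContDiffOn ℝ ∞ (fderivWithin ℝ (zeroExtend φ.1) s) s :=
  (contDiffOn_coe φ).fderivWithin hs (by simp)

/-- The directional derivative within `s`. -/
def dirDeriv (hs : UniqueDiffOn ℝ s) (e : F) : Derivation ℝ (smoothRing s) (smoothRing s) :=
  Derivation.mk'
    { toFun := fun φ => mk (fun x => fderivWithin ℝ (zeroExtend φ.1) s x e)
        ((contDiffOn_fderivWithin hs φ).clm_apply contDiffOn_const)
      map_add' := fun φ ψ => by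
        refine ext_ev fun p => ?_
        have h : EqOn (zeroExtend (φ + ψ).1) (zeroExtend φ.1 + zeroExtend ψ.1) s :=
          eqOn_zeroExtend fun x => by simp [zeroExtend_apply]
        rw [map_add, ev_mk, ev_mk, ev_mk, fderivWithin_congr h (h p.2),
          fderivWithin_add (hs p p.2) (differentiableWithinAt_coe φ p) (differentiableWithinAt_coe ψ p)]
        rfl
      map_smul' := fun c φ => by
        refine ext_ev fun p => ?_
        have h : EqOn (zeroExtend (c • φ).1) (c • zeroExtend φ.1) s :=
          eqOn_zeroExtend fun x => by simp [zeroExtend_apply]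
        rw [map_smul, ev_mk, ev_mk, fderivWithin_congr h (h p.2),
          fderivWithin_const_smul (hs p p.2) (differentiableWithinAt_coe φ p)]
        rfl }
    fun φ ψ => by
      refine ext_ev fun p => ?_
      have h : EqOn (zeroExtend (φ * ψ).1) (zeroExtend φ.1 * zeroExtend ψ.1) s :=
        eqOn_zeroExtend fun x => by simp [zeroExtend_apply]
      simp only [LinearMap.coe_mk, AddHom.coe_mk, smul_eq_mul, map_add, map_mul, ev_mk]
      rw [fderivWithin_congr h (h p.2),
        fderivWithin_mul (hs p p.2) (differentiableWithinAt_coe φ p) (differentiableWithinAt_coe ψ p)]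
      simp [zeroExtend_apply, ev_apply]

theorem ev_dirDeriv (hs : UniqueDiffOn ℝ s) (e : F) (φ : smoothRing s) (p : s) :
    ev p (dirDeriv hs e φ) = fderivWithin ℝ (zeroExtend φ.1) s p e := rfl

theorem hasFDerivWithinAt {φ : smoothRing s} {Φ : F → ℝ} (h : ∀ p : s, ev p φ = Φ p) (p : s) :
    HasFDerivWithinAt Φ (fderivWithin ℝ (zeroExtend φ.1) s p) s p :=
  (differentiableWithinAt_coe φ p).hasFDerivWithinAt.congr (fun _ hx => (eqOn h hx).symm)
    (eqOn h p.2).symm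

/-- Symmetry of the second derivative within `s`. The condition `hs'` lets it pass from interior
points to boundary points, here the time `0`. -/
theorem dirDeriv_comm (hs : UniqueDiffOn ℝ s) (hs' : s ⊆ closure (interior s)) (e e' : F)
    (φ : smoothRing s) : dirDeriv hs e (dirDeriv hs e' φ) = dirDeriv hs e' (dirDeriv hs e φ) := by
  refine ext_ev fun p => ?_
  have hsymm : IsSymmSndFDerivWithinAt ℝ (zeroExtend φ.1) s p :=
    (contDiffOn_coe φ p p.2).isSymmSndFDerivWithinAt
      (by rw [minSmoothness_of_isRCLikeNormedField]; exact ENat.LEInfty.out) hs (hs' p.2) p.2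
  have h : ∀ e e' : F, ev p (dirDeriv hs e (dirDeriv hs e' φ))
      = fderivWithin ℝ (fderivWithin ℝ (zeroExtend φ.1) s) s p e e' := by
    intro e e'
    have h1 := hasFDerivWithinAt (φ := dirDeriv hs e' φ)
      (Φ := fun x => fderivWithin ℝ (zeroExtend φ.1) s x e') (fun q => ev_dirDeriv hs e' φ q) p
    have h2 : HasFDerivWithinAt (fderivWithin ℝ (zeroExtend φ.1) s)
        (fderivWithin ℝ (fderivWithin ℝ (zeroExtend φ.1) s) s p) s p :=
      (((contDiffOn_fderivWithin hs φ).differentiableOn (by simp)) p p.2).hasFDerivWithinAt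
    have h3 := h2.clm_apply (hasFDerivWithinAt_const e' _ _)
    rw [ev_dirDeriv, (hs p p.2).eq h1 h3]
    simp
  rw [h, h]
  exact hsymm e e'

end smoothRing

end SmoothRing

/-! ### Smooth functions of time and space -/

section SpaceTime

theorem prod_subset_closure_interior {E : Type*} [TopologicalSpace E] {J : Set ℝ} {U : Set E}
    (hJ : J ⊆ closure (interior J)) (hU : IsOpen U) :
    J ×ˢ U ⊆ closure (interior (J ×ˢ U)) := by
  rw [interior_prod_eq, hU.interior_eq, closure_prod_eq]
  exact prod_mono hJ subset_closure

variable {E : Type*} [NormedAddCommGroup E] [NormedSpace ℝ E] {J : Set ℝ} {U : Set E}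

namespace smoothRing

/-- The slice of `J ×ˢ U` at a fixed time is the open set `U`, so in spatial directions the
derivative within the set is the ordinary one. In the time direction only the derivative within `J`
is available. -/
theorem fderiv_space (hs : UniqueDiffOn ℝ (J ×ˢ U)) (hU : IsOpen U) {φ : smoothRing (J ×ˢ U)}
    {W : ℝ → E → ℝ} (h : ∀ p : ↥(J ×ˢ U), ev p φ = W p.1.1 p.1.2) (p : ↥(J ×ˢ U)) (e : E) :
    fderiv ℝ (W p.1.1) p.1.2 e = ev p (dirDeriv hs (0, e) φ) := by
  have h1 := hasFDerivWithinAt (Φ := fun q : ℝ × E => W q.1 q.2) h p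
  have h2 : HasFDerivWithinAt (fun z : E => (p.1.1, z)) (ContinuousLinearMap.inr ℝ ℝ E) U p.1.2 :=
    (hasFDerivAt_prodMk_right p.1.1 p.1.2).hasFDerivWithinAt
  have h3 := HasFDerivWithinAt.comp p.1.2 (g := fun q : ℝ × E => W q.1 q.2) (t := J ×ˢ U) h1 h2
    (fun z hz => ⟨p.2.1, hz⟩)
  have h4 := h3.hasFDerivAt (hU.mem_nhds p.2.2)
  have h5 : ((fun q : ℝ × E => W q.1 q.2) ∘ fun z : E => (p.1.1, z)) = W p.1.1 := rfl
  rw [h5] at h4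
  rw [h4.fderiv, ev_dirDeriv]
  simp

theorem hasDerivWithinAt_time (hs : UniqueDiffOn ℝ (J ×ˢ U)) {φ : smoothRing (J ×ˢ U)}
    {W : ℝ → E → ℝ} (h : ∀ p : ↥(J ×ˢ U), ev p φ = W p.1.1 p.1.2) (p : ↥(J ×ˢ U)) :
    HasDerivWithinAt (fun t => W t p.1.2) (ev p (dirDeriv hs (1, 0) φ)) J p.1.1 := by
  have h1 := hasFDerivWithinAt (Φ := fun q : ℝ × E => W q.1 q.2) h p
  have h2 : HasFDerivWithinAt (fun t : ℝ => (t, p.1.2)) (ContinuousLinearMap.inl ℝ ℝ E) J p.1.1 :=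
    (hasFDerivAt_prodMk_left p.1.1 p.1.2).hasFDerivWithinAt
  have h3 := HasFDerivWithinAt.comp p.1.1 (g := fun q : ℝ × E => W q.1 q.2) (t := J ×ˢ U) h1 h2
    (fun z hz => ⟨hz, p.2.2⟩)
  have h4 := h3.hasDerivWithinAt
  have h5 : ((fun q : ℝ × E => W q.1 q.2) ∘ fun t : ℝ => (t, p.1.2)) = fun t => W t p.1.2 := rfl
  rw [h5] at h4
  have h6 : (fderivWithin ℝ (zeroExtend φ.1) (J ×ˢ U) p ∘L ContinuousLinearMap.inl ℝ ℝ E) 1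
      = ev p (dirDeriv hs (1, 0) φ) := by simp [ev_dirDeriv]
  rwa [h6] at h4

end smoothRing

end SpaceTime

/-! ### Coordinate formulas as evaluations -/

namespace EvolvingMetric

open smoothRing

variable {n : ℕ} {J : Set ℝ} {U : Set (EuclideanSpace ℝ (Fin n))}

/-- The metric on `J ×ˢ U` with the given Gram matrix of smooth functions. -/
def spaceTimeMetric (hJ : UniqueDiffOn ℝ J) (hJ' : J ⊆ closure (interior J)) (hU : IsOpen U)
    (G : Matrix (Fin n) (Fin n) (smoothRing (J ×ˢ U))) (hG : Gᵀ = G) (hdet : IsUnit G.det) :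
    AlgMetric (Fin n) (smoothRing (J ×ˢ U)) where
  D i := dirDeriv (hJ.prod hU.uniqueDiffOn) (0, EuclideanSpace.single i 1)
  D_comm _ _ F := dirDeriv_comm _ (prod_subset_closure_interior hJ' hU) _ _ F
  G := G
  H := G⁻¹
  G_symm := hG
  G_mul_H := Matrix.mul_nonsing_inv _ hdet

/-- The algebraic metric `𝔤` over `smoothRing (J ×ˢ U)` has components `G t y` at `(t, y)`, and its
derivations are the spatial partial derivatives. -/
structure Represents (hJ : UniqueDiffOn ℝ J) (hU : IsOpen U)
    (𝔤 : AlgMetric (Fin n) (smoothRing (J ×ˢ U)))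
    (G : ℝ → EuclideanSpace ℝ (Fin n) → Matrix (Fin n) (Fin n) ℝ) : Prop where
  D_eq : ∀ i, 𝔤.D i = dirDeriv (hJ.prod hU.uniqueDiffOn) (0, EuclideanSpace.single i 1)
  G_eq : ∀ (p : ↥(J ×ˢ U)) i j, ev p (𝔤.G i j) = G p.1.1 p.1.2 i j

namespace Represents

variable {hJ : UniqueDiffOn ℝ J} {hU : IsOpen U} {𝔤 : AlgMetric (Fin n) (smoothRing (J ×ˢ U))}
  {G : ℝ → EuclideanSpace ℝ (Fin n) → Matrix (Fin n) (Fin n) ℝ}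

/-- `hφ` is required at every point, not only at `p`, so the rule applies to its own output; this
yields second derivatives and derivatives of Christoffel symbols. -/
theorem partialDeriv_eq (h : Represents hJ hU 𝔤 G) {φ : smoothRing (J ×ˢ U)}
    {W : ℝ → EuclideanSpace ℝ (Fin n) → ℝ} (hφ : ∀ p : ↥(J ×ˢ U), ev p φ = W p.1.1 p.1.2)
    (i : Fin n) (p : ↥(J ×ˢ U)) : ev p (𝔤.D i φ) = partialDeriv i (W p.1.1) p.1.2 := by
  rw [h.D_eq, partialDeriv, fderiv_space (hJ.prod hU.uniqueDiffOn) hU hφ]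

theorem G_matrix_eq (h : Represents hJ hU 𝔤 G) (p : ↥(J ×ˢ U)) :
    (ev p).mapMatrix 𝔤.G = G p.1.1 p.1.2 := by
  ext i j
  exact h.G_eq p i j

theorem H_matrix_eq (h : Represents hJ hU 𝔤 G) (p : ↥(J ×ˢ U)) :
    (ev p).mapMatrix 𝔤.H = (G p.1.1 p.1.2)⁻¹ := by
  symm
  apply Matrix.inv_eq_left_inv
  rw [← h.G_matrix_eq, ← map_mul, 𝔤.H_mul_G, map_one]

theorem H_eq (h : Represents hJ hU 𝔤 G) (p : ↥(J ×ˢ U)) (i j : Fin n) :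
    ev p (𝔤.H i j) = (G p.1.1 p.1.2)⁻¹ i j := by
  rw [← h.H_matrix_eq]; rfl

theorem Γ_eq (h : Represents hJ hU 𝔤 G) (p : ↥(J ×ˢ U)) (k i j : Fin n) :
    ev p (𝔤.Γ i k j) = christoffel (G p.1.1) k i j p.1.2 := by
  have hD : ∀ i j l : Fin n, ev p (𝔤.D i (𝔤.G j l)) = partialDeriv i (fun z => G p.1.1 z j l) p.1.2 :=
    fun i j l => h.partialDeriv_eq (W := fun t z => G t z j l) (fun q => h.G_eq q j l) i p
  simp only [AlgMetric.Γ, Matrix.of_apply, map_mul, map_sum, map_sub, map_add, hD, h.H_eq,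
    christoffel, AlgHom.commutes]
  rfl

theorem hess_eq (h : Represents hJ hU 𝔤 G) {φ : smoothRing (J ×ˢ U)}
    {W : ℝ → EuclideanSpace ℝ (Fin n) → ℝ} (hφ : ∀ p : ↥(J ×ˢ U), ev p φ = W p.1.1 p.1.2)
    (p : ↥(J ×ˢ U)) (i j : Fin n) :
    ev p (𝔤.hess φ i j) = coordHess (G p.1.1) (W p.1.1) p.1.2 i j := by
  have h2 := h.partialDeriv_eq (W := fun t => partialDeriv j (W t))
    (fun q => h.partialDeriv_eq hφ j q) i p
  simp only [AlgMetric.hess_apply, map_sub, map_sum, map_mul, h.Γ_eq, h.partialDeriv_eq hφ, h2,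
    coordHess, Matrix.of_apply]

theorem ricci_eq (h : Represents hJ hU 𝔤 G) (p : ↥(J ×ˢ U)) (j k : Fin n) :
    ev p (𝔤.ricci j k) = coordRicci (G p.1.1) p.1.2 j k := by
  have h2 : ∀ i a b c, ev p (𝔤.D i (𝔤.Γ a b c)) = partialDeriv i (christoffel (G p.1.1) b a c) p.1.2 :=
    fun i a b c => h.partialDeriv_eq (W := fun t => christoffel (G t) b a c)
      (fun q => h.Γ_eq q b a c) i p
  simp only [AlgMetric.ricci, AlgMetric.curv, coordRicci, Matrix.of_apply, map_sum, Matrix.sub_apply,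
    Matrix.add_apply, Matrix.map_apply, Matrix.mul_apply, map_sub, map_add, map_mul, h.Γ_eq, h2,
    Finset.sum_sub_distrib, Finset.sum_add_distrib]
  ring

variable {A : Matrix (Fin n) (Fin n) (smoothRing (J ×ˢ U))}
  {B : ℝ → EuclideanSpace ℝ (Fin n) → Matrix (Fin n) (Fin n) ℝ}

theorem div_eq (h : Represents hJ hU 𝔤 G)
    (hA : ∀ (p : ↥(J ×ˢ U)) i j, ev p (A i j) = B p.1.1 p.1.2 i j) (p : ↥(J ×ˢ U)) (k : Fin n) :
    ev p (𝔤.div A k) = coordDiv (G p.1.1) (B p.1.1) k p.1.2 := by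
  have hD : ∀ i j l : Fin n, ev p (𝔤.D i (A j l)) = partialDeriv i (fun z => B p.1.1 z j l) p.1.2 :=
    fun i j l => h.partialDeriv_eq (W := fun t z => B t z j l) (fun q => hA q j l) i p
  simp only [AlgMetric.div, AlgMetric.cov, coordDiv, coordCovDeriv, map_sum, map_mul,
    Matrix.sub_apply, Matrix.map_apply, Matrix.mul_apply, map_sub, Matrix.transpose_apply, hD,
    h.Γ_eq, h.H_eq, hA, Finset.sum_add_distrib]
  refine Finset.sum_congr rfl fun i _ => Finset.sum_congr rfl fun j _ => ?_
  have e : ∀ a b : Fin n → ℝ, ∑ x, a x * b x = ∑ x, b x * a x :=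
    fun a b => Finset.sum_congr rfl fun _ _ => mul_comm _ _
  rw [e (fun x => B p.1.1 p.1.2 j x)]
  ring

theorem tr_eq (h : Represents hJ hU 𝔤 G) (p : ↥(J ×ˢ U)) {C : Matrix (Fin n) (Fin n) ℝ}
    (hA : ∀ i j, ev p (A i j) = C i j) : ev p (𝔤.tr A) = coordTrace (G p.1.1 p.1.2) C := by
  simp only [AlgMetric.tr, coordTrace, map_sum, map_mul, h.H_eq, hA]

theorem inner_eq (h : Represents hJ hU 𝔤 G) (p : ↥(J ×ˢ U)) {C : Matrix (Fin n) (Fin n) ℝ}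
    (hA : ∀ i j, ev p (A i j) = C i j) : ev p (𝔤.inner A A) = coordNormSq (G p.1.1 p.1.2) C := by
  simp only [AlgMetric.inner, coordNormSq, map_sum, map_mul, h.H_eq, hA]

theorem lap_eq (h : Represents hJ hU 𝔤 G) {φ : smoothRing (J ×ˢ U)}
    {W : ℝ → EuclideanSpace ℝ (Fin n) → ℝ} (hφ : ∀ p : ↥(J ×ˢ U), ev p φ = W p.1.1 p.1.2)
    (p : ↥(J ×ˢ U)) :
    ev p (𝔤.lap φ) = coordTrace (G p.1.1 p.1.2) (coordHess (G p.1.1) (W p.1.1) p.1.2) :=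
  h.tr_eq p fun i j => h.hess_eq hφ p i j

end Represents

end EvolvingMetric

namespace EvolvingMetric

/-! ### Coordinate frames -/

section Frame

variable {n : ℕ} {M : Type*} [TopologicalSpace M] [ChartedSpace (EuclideanSpace ℝ (Fin n)) M]

theorem extChartAt_symm_mem_source {p : M} {y : EuclideanSpace ℝ (Fin n)}
    (hy : y ∈ (extChartAt (𝓡 n) p).target) :
    (extChartAt (𝓡 n) p).symm y ∈ (chartAt (EuclideanSpace ℝ (Fin n)) p).source := by
  have := (extChartAt (𝓡 n) p).map_target hy
  rwa [extChartAt_source] at this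

variable [IsManifold (𝓡 n) ∞ M]

/-- The coordinate vector field `∂_i` of the chart at `p`, at the point `x`. -/
def chartVec (p : M) (i : Fin n) (x : M) : TangentSpace (𝓡 n) x :=
  (trivializationAt (EuclideanSpace ℝ (Fin n)) (TangentSpace (𝓡 n)) p).symmL ℝ x
    (EuclideanSpace.single i (1 : ℝ))

/-- The components of a tangent vector at `x` in the chart at `p`. -/
def chartCoord (p : M) (x : M) (V : TangentSpace (𝓡 n) x) : EuclideanSpace ℝ (Fin n) :=
  (trivializationAt (EuclideanSpace ℝ (Fin n)) (TangentSpace (𝓡 n)) p).continuousLinearMapAt ℝ x V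

variable {p x : M}

theorem mem_baseSet_of_mem_source (hx : x ∈ (chartAt (EuclideanSpace ℝ (Fin n)) p).source) :
    x ∈ (trivializationAt (EuclideanSpace ℝ (Fin n)) (TangentSpace (𝓡 n)) p).baseSet := by
  simpa using hx

theorem sum_chartCoord_smul_chartVec (hx : x ∈ (chartAt (EuclideanSpace ℝ (Fin n)) p).source)
    (V : TangentSpace (𝓡 n) x) : ∑ i, chartCoord p x V i • chartVec p i x = V := by
  have hb := mem_baseSet_of_mem_source hx
  have h1 : ∑ i, chartCoord p x V i • EuclideanSpace.single i (1 : ℝ) = chartCoord p x V := by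
    ext j
    simp [Finset.sum_apply, Pi.single_apply]
  have h2 := Trivialization.symmL_continuousLinearMapAt (R := ℝ)
    (trivializationAt (EuclideanSpace ℝ (Fin n)) (TangentSpace (𝓡 n)) p) hb V
  have h3 : (trivializationAt (EuclideanSpace ℝ (Fin n)) (TangentSpace (𝓡 n)) p).symmL ℝ x
      (chartCoord p x V) = V := h2
  rw [← h1, map_sum] at h3
  simp only [map_smul] at h3
  exact h3

theorem chartCoord_chartVec (hx : x ∈ (chartAt (EuclideanSpace ℝ (Fin n)) p).source) (i : Fin n) :
    chartCoord p x (chartVec p i x) = EuclideanSpace.single i (1 : ℝ) :=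
  Trivialization.continuousLinearMapAt_symmL (R := ℝ)
    (trivializationAt (EuclideanSpace ℝ (Fin n)) (TangentSpace (𝓡 n)) p)
    (mem_baseSet_of_mem_source hx) _

theorem chartCoord_eq_mvfderiv (hx : x ∈ (chartAt (EuclideanSpace ℝ (Fin n)) p).source)
    (V : TangentSpace (𝓡 n) x) :
    chartCoord p x V = mvfderiv (𝓡 n) (extChartAt (𝓡 n) p) x V := by
  have h := TangentBundle.continuousLinearMapAt_trivializationAt (𝕜 := ℝ) (I := 𝓡 n) hx
  unfold chartCoord
  rw [h]
  rfl

/-- Links the frame defined by the chart with the frame defined by the trivialization of the tangent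
bundle, for which smoothness and dual coordinates are at hand. -/
theorem coordVec_eq_chartVec {y : EuclideanSpace ℝ (Fin n)}
    (hy : y ∈ (extChartAt (𝓡 n) p).target) (i : Fin n) :
    coordVec p i y = chartVec p i ((extChartAt (𝓡 n) p).symm y) := by
  have h := TangentBundle.symmL_trivializationAt (𝕜 := ℝ) (I := 𝓡 n) (extChartAt_symm_mem_source hy)
  -- The base point is generalized, with values read in the model space, because the tangent space
  -- in the statement depends on it.
  have key : ∀ y', y' = y →
      (mfderivWithin 𝓘(ℝ, EuclideanSpace ℝ (Fin n)) (𝓡 n) (extChartAt (𝓡 n) p).symm (range (𝓡 n)) y'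
        (EuclideanSpace.single i (1 : ℝ) : EuclideanSpace ℝ (Fin n)) : EuclideanSpace ℝ (Fin n))
      = coordVec p i y := by
    rintro _ rfl
    rw [ModelWithCorners.range_eq_univ, mfderivWithin_univ]
    rfl
  have h2 := key _ ((extChartAt (𝓡 n) p).right_inv hy)
  unfold chartVec
  rw [h]
  exact h2.symm

theorem mdifferentiableAt_extChartAt_symm' {y : EuclideanSpace ℝ (Fin n)}
    (hy : y ∈ (extChartAt (𝓡 n) p).target) :
    MDifferentiableAt 𝓘(ℝ, EuclideanSpace ℝ (Fin n)) (𝓡 n) (extChartAt (𝓡 n) p).symm y := by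
  have := mdifferentiableWithinAt_extChartAt_symm (I := 𝓡 n) hy
  rwa [ModelWithCorners.range_eq_univ, mdifferentiableWithinAt_univ] at this

theorem mvfderiv_coordVec {f : M → ℝ} {y : EuclideanSpace ℝ (Fin n)}
    (hy : y ∈ (extChartAt (𝓡 n) p).target)
    (hf : MDifferentiableAt (𝓡 n) 𝓘(ℝ, ℝ) f ((extChartAt (𝓡 n) p).symm y)) (i : Fin n) :
    mvfderiv (𝓡 n) f ((extChartAt (𝓡 n) p).symm y) (coordVec p i y)
      = partialDeriv i (localFun f p) y := by
  have h := mvfderiv_comp_apply y hf (mdifferentiableAt_extChartAt_symm' hy)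
    ((NormedSpace.fromTangentSpace y).symm (EuclideanSpace.single i (1 : ℝ)))
  rw [coordVec, ← h, partialDeriv, mvfderiv, mfderiv_eq_fderiv]
  rfl

theorem mvfderiv_chartVec {f : M → ℝ} (hx : x ∈ (chartAt (EuclideanSpace ℝ (Fin n)) p).source)
    (hf : MDifferentiableAt (𝓡 n) 𝓘(ℝ, ℝ) f x) (i : Fin n) :
    mvfderiv (𝓡 n) f x (chartVec p i x) = partialDeriv i (localFun f p) (extChartAt (𝓡 n) p x) := by
  have hx' : x ∈ (extChartAt (𝓡 n) p).source := by rwa [extChartAt_source]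
  have hy := (extChartAt (𝓡 n) p).map_source hx'
  have hl := (extChartAt (𝓡 n) p).left_inv hx'
  have h := mvfderiv_coordVec (f := f) hy (by rwa [hl]) i
  rw [coordVec_eq_chartVec hy, hl] at h
  exact h

theorem localTensor_eq_chartVec (A : TwoTensor n M) {y : EuclideanSpace ℝ (Fin n)}
    (hy : y ∈ (extChartAt (𝓡 n) p).target) (i j : Fin n) :
    localTensor A p y i j = A ((extChartAt (𝓡 n) p).symm y)
      (chartVec p i ((extChartAt (𝓡 n) p).symm y)) (chartVec p j ((extChartAt (𝓡 n) p).symm y)) := by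
  rw [localTensor, Matrix.of_apply, coordVec_eq_chartVec hy, coordVec_eq_chartVec hy]

theorem localTensor_extChartAt (A : TwoTensor n M)
    (hx : x ∈ (chartAt (EuclideanSpace ℝ (Fin n)) p).source) (i j : Fin n) :
    localTensor A p (extChartAt (𝓡 n) p x) i j = A x (chartVec p i x) (chartVec p j x) := by
  have hx' : x ∈ (extChartAt (𝓡 n) p).source := by rwa [extChartAt_source]
  rw [localTensor_eq_chartVec A ((extChartAt (𝓡 n) p).map_source hx'),
    (extChartAt (𝓡 n) p).left_inv hx']

theorem twoTensor_apply (A : TwoTensor n M)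
    (hx : x ∈ (chartAt (EuclideanSpace ℝ (Fin n)) p).source) (V W : TangentSpace (𝓡 n) x) :
    A x V W = ∑ i, ∑ j, chartCoord p x V i * chartCoord p x W j *
      localTensor A p (extChartAt (𝓡 n) p x) i j := by
  conv_lhs => rw [← sum_chartCoord_smul_chartVec hx V, ← sum_chartCoord_smul_chartVec hx W]
  simp only [map_sum, map_smul, _root_.sum_apply, _root_.smul_apply,
    smul_eq_mul, Finset.mul_sum, localTensor_extChartAt A hx]
  rw [Finset.sum_comm]
  exact Finset.sum_congr rfl fun i _ => Finset.sum_congr rfl fun j _ => by ring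

/-- The Jacobian of the transition from the chart at `p` to the chart at `q`. -/
def chartJacobian (p q x : M) : Matrix (Fin n) (Fin n) ℝ :=
  Matrix.of fun c j => chartCoord q x (chartVec p j x) c

theorem localTensor_change {q : M} (A : TwoTensor n M)
    (hp : x ∈ (chartAt (EuclideanSpace ℝ (Fin n)) p).source)
    (hq : x ∈ (chartAt (EuclideanSpace ℝ (Fin n)) q).source) :
    localTensor A p (extChartAt (𝓡 n) p x) = (chartJacobian p q x)ᵀ *
      localTensor A q (extChartAt (𝓡 n) q x) * chartJacobian p q x := by
  ext i j
  rw [localTensor_extChartAt A hp, twoTensor_apply A hq]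
  simp only [Matrix.mul_apply, Matrix.transpose_apply, chartJacobian, Matrix.of_apply,
    Finset.sum_mul]
  rw [Finset.sum_comm]
  exact Finset.sum_congr rfl fun i _ => Finset.sum_congr rfl fun j _ => by ring

variable (g : ContMDiffRiemannianMetric (𝓡 n) ∞ (EuclideanSpace ℝ (Fin n))
      (fun x : M => TangentSpace (𝓡 n) x))

/-- A kernel vector of the Gram matrix gives a tangent vector with `g(V, V) = 0`, which vanishes by
positivity. -/
theorem isUnit_localTensor_metric (hx : x ∈ (chartAt (EuclideanSpace ℝ (Fin n)) p).source) :
    IsUnit (localTensor g.inner p (extChartAt (𝓡 n) p x)) := by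
  rw [← Matrix.mulVec_injective_iff_isUnit]
  refine (injective_iff_map_eq_zero
    (Matrix.mulVecLin (localTensor g.inner p (extChartAt (𝓡 n) p x)))).2 fun v hv => ?_
  set V : TangentSpace (𝓡 n) x := ∑ i, v i • chartVec p i x with hV
  have hc : ∀ i, chartCoord p x V i = v i := fun i => by
    have : chartCoord p x V = ∑ i, v i • chartCoord p x (chartVec p i x) := by
      simp only [chartCoord, hV, map_sum, map_smul]
    rw [this]
    simp [chartCoord_chartVec hx, Pi.single_apply]
  have h0 : g.inner x V V = 0 := by
    rw [twoTensor_apply g.inner hx]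
    simp only [hc]
    have : ∑ i, ∑ j, v i * v j * localTensor g.inner p (extChartAt (𝓡 n) p x) i j
        = ∑ i, v i * (localTensor g.inner p (extChartAt (𝓡 n) p x)).mulVec v i := by
      simp only [Matrix.mulVec, dotProduct, Finset.mul_sum]
      exact Finset.sum_congr rfl fun i _ => Finset.sum_congr rfl fun j _ => by ring
    have hv' : (localTensor g.inner p (extChartAt (𝓡 n) p x)).mulVec v = 0 := hv
    rw [this, hv']
    exact Finset.sum_eq_zero fun i _ => mul_zero _
  have hV0 : V = 0 := by
    by_contra h
    exact (g.pos x V h).ne' h0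
  ext i
  rw [← hc, hV0]
  simp [chartCoord]

theorem localTensor_metric_symm (hx : x ∈ (chartAt (EuclideanSpace ℝ (Fin n)) p).source) :
    (localTensor g.inner p (extChartAt (𝓡 n) p x))ᵀ
      = localTensor g.inner p (extChartAt (𝓡 n) p x) := by
  ext i j
  rw [Matrix.transpose_apply, localTensor_extChartAt _ hx, localTensor_extChartAt _ hx, g.symm]

/-- `ContinuousLinearMap.inverse` is zero on non-invertible maps; an explicit two-sided inverse
shows that `riemGradient` is never this default value. -/
theorem exists_metric_inverse (hx : x ∈ (chartAt (EuclideanSpace ℝ (Fin n)) p).source) :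
    ∃ K : (TangentSpace (𝓡 n) x →L[ℝ] ℝ) →L[ℝ] TangentSpace (𝓡 n) x,
      (g.inner x).comp K = ContinuousLinearMap.id ℝ _ ∧
      K.comp (g.inner x) = ContinuousLinearMap.id ℝ _ ∧
      ∀ ℓ, K ℓ = ∑ i, (∑ j, (localTensor g.inner p (extChartAt (𝓡 n) p x))⁻¹ i j *
        ℓ (chartVec p j x)) • chartVec p i x := by
  set G := localTensor g.inner p (extChartAt (𝓡 n) p x) with hG
  have hu : IsUnit G.det := (Matrix.isUnit_iff_isUnit_det _).1 (isUnit_localTensor_metric g hx)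
  let e (j : Fin n) : (TangentSpace (𝓡 n) x →L[ℝ] ℝ) →L[ℝ] ℝ :=
    { toFun := fun ℓ => ℓ (chartVec p j x)
      map_add' := fun _ _ => rfl
      map_smul' := fun _ _ => rfl
      cont := continuous_eval_const _ }
  let K : (TangentSpace (𝓡 n) x →L[ℝ] ℝ) →L[ℝ] TangentSpace (𝓡 n) x :=
    ∑ i, ∑ j, G⁻¹ i j • (e j).smulRight (chartVec p i x)
  have hK : ∀ ℓ, K ℓ = ∑ i, (∑ j, G⁻¹ i j * ℓ (chartVec p j x)) • chartVec p i x := fun ℓ => by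
    simp only [K, e, Finset.sum_smul, mul_smul, _root_.sum_apply, _root_.smul_apply,
      ContinuousLinearMap.smulRight_apply]
    rfl
  have hext : ∀ ℓ ℓ' : TangentSpace (𝓡 n) x →L[ℝ] ℝ,
      (∀ k, ℓ (chartVec p k x) = ℓ' (chartVec p k x)) → ℓ = ℓ' := by
    intro ℓ ℓ' h
    ext V
    rw [← sum_chartCoord_smul_chartVec hx V]
    simp [h]
  have hgK : ∀ ℓ, g.inner x (K ℓ) = ℓ := by
    intro ℓ
    refine hext _ _ fun k => ?_
    have h1 : ∀ i, g.inner x (chartVec p i x) (chartVec p k x) = G k i := fun i => by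
      rw [g.symm, hG, localTensor_extChartAt _ hx]
    rw [hK]
    simp only [map_sum, map_smul, _root_.sum_apply, _root_.smul_apply,
      smul_eq_mul, h1]
    have h2 : ∑ i, (∑ j, G⁻¹ i j * ℓ (chartVec p j x)) * G k i
        = (G *ᵥ (G⁻¹ *ᵥ fun j => ℓ (chartVec p j x))) k := by
      simp only [Matrix.mulVec, dotProduct]
      exact Finset.sum_congr rfl fun i _ => mul_comm _ _
    rw [h2, Matrix.mulVec_mulVec, Matrix.mul_nonsing_inv _ hu, Matrix.one_mulVec]
  have hinj : ∀ V : TangentSpace (𝓡 n) x, g.inner x V = 0 → V = 0 := by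
    intro V h
    by_contra hV
    exact (g.pos x V hV).ne' (by rw [h]; rfl)
  have h1 : (g.inner x).comp K = ContinuousLinearMap.id ℝ _ := by
    ext1 ℓ
    exact hgK ℓ
  have h2 : K.comp (g.inner x) = ContinuousLinearMap.id ℝ _ := by
    ext1 V
    refine sub_eq_zero.1 (hinj _ ?_)
    rw [map_sub]
    exact sub_eq_zero.2 (hgK _)
  exact ⟨K, h1, h2, hK⟩

/-- The musical isomorphism in coordinates. -/
theorem inverse_metric_apply (hx : x ∈ (chartAt (EuclideanSpace ℝ (Fin n)) p).source)
    (ℓ : TangentSpace (𝓡 n) x →L[ℝ] ℝ) :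
    (g.inner x).inverse ℓ = ∑ i, (∑ j, (localTensor g.inner p (extChartAt (𝓡 n) p x))⁻¹ i j *
      ℓ (chartVec p j x)) • chartVec p i x := by
  obtain ⟨K, h1, h2, hK⟩ := exists_metric_inverse g hx
  rw [ContinuousLinearMap.inverse_eq h1 h2, hK]

theorem metric_riemGradient (f : M → ℝ) (x : M) (V : TangentSpace (𝓡 n) x) :
    g.inner x (riemGradient g.inner f x) V = mvfderiv (𝓡 n) f x V := by
  obtain ⟨K, h1, h2, -⟩ := exists_metric_inverse (p := x) g (mem_chart_source _ x)
  rw [riemGradient, ContinuousLinearMap.inverse_eq h1 h2, ← ContinuousLinearMap.comp_apply, h1]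
  rfl

theorem chartCoord_riemGradient {f : M → ℝ}
    (hx : x ∈ (chartAt (EuclideanSpace ℝ (Fin n)) p).source)
    (hf : MDifferentiableAt (𝓡 n) 𝓘(ℝ, ℝ) f x) (i : Fin n) :
    chartCoord p x (riemGradient g.inner f x) i =
      ∑ j, (localTensor g.inner p (extChartAt (𝓡 n) p x))⁻¹ i j *
        partialDeriv j (localFun f p) (extChartAt (𝓡 n) p x) := by
  rw [riemGradient, inverse_metric_apply g hx]
  simp only [mvfderiv_chartVec hx hf]
  set c : Fin n → ℝ := fun i => ∑ j, (localTensor g.inner p (extChartAt (𝓡 n) p x))⁻¹ i j *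
    partialDeriv j (localFun f p) (extChartAt (𝓡 n) p x) with hc
  have : chartCoord p x (∑ i, c i • chartVec p i x)
      = ∑ i, c i • chartCoord p x (chartVec p i x) := by
    simp only [chartCoord, map_sum, map_smul]
  rw [this]
  have h : (∑ k, c k • chartCoord p x (chartVec p k x)) i = c i := by
    simp [chartCoord_chartVec hx, Pi.single_apply]
  rw [h]

/-- The inner product of gradients in coordinates. -/
theorem metric_riemGradient_riemGradient {a b : M → ℝ}
    (hx : x ∈ (chartAt (EuclideanSpace ℝ (Fin n)) p).source)
    (ha : MDifferentiableAt (𝓡 n) 𝓘(ℝ, ℝ) a x) (hb : MDifferentiableAt (𝓡 n) 𝓘(ℝ, ℝ) b x) :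
    g.inner x (riemGradient g.inner a x) (riemGradient g.inner b x) =
      ∑ i, partialDeriv i (localFun a p) (extChartAt (𝓡 n) p x) *
        ∑ j, (localTensor g.inner p (extChartAt (𝓡 n) p x))⁻¹ i j *
          partialDeriv j (localFun b p) (extChartAt (𝓡 n) p x) := by
  rw [metric_riemGradient, ← sum_chartCoord_smul_chartVec hx (riemGradient g.inner b x), map_sum]
  refine Finset.sum_congr rfl fun i _ => ?_
  rw [map_smul, mvfderiv_chartVec hx ha, chartCoord_riemGradient g hx hb, smul_eq_mul, mul_comm]

end Frame

end EvolvingMetric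

namespace EvolvingMetric

open smoothRing

variable {n : ℕ} {M : Type*} [TopologicalSpace M] [ChartedSpace (EuclideanSpace ℝ (Fin n)) M]

/-! ### Smoothness in coordinates -/

/-- The image of `O` under the chart at `p`. -/
def chartImage (n : ℕ) {M : Type*} [TopologicalSpace M]
    [ChartedSpace (EuclideanSpace ℝ (Fin n)) M] (p : M) (O : Set M) : Set (EuclideanSpace ℝ (Fin n)) :=
  (extChartAt (𝓡 n) p).target ∩ (extChartAt (𝓡 n) p).symm ⁻¹' O

theorem isOpen_chartImage (p : M) {O : Set M} (hO : IsOpen O) : IsOpen (chartImage n p O) :=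
  (continuousOn_extChartAt_symm p).isOpen_inter_preimage (isOpen_extChartAt_target p) hO

theorem extChartAt_mem_chartImage {p x : M} {O : Set M} (hx : x ∈ O)
    (hp : x ∈ (chartAt (EuclideanSpace ℝ (Fin n)) p).source) :
    extChartAt (𝓡 n) p x ∈ chartImage n p O := by
  have hx' : x ∈ (extChartAt (𝓡 n) p).source := by rwa [extChartAt_source]
  refine ⟨(extChartAt (𝓡 n) p).map_source hx', ?_⟩
  rwa [mem_preimage, (extChartAt (𝓡 n) p).left_inv hx']

theorem extChartAt_symm_extChartAt {p x : M}
    (hp : x ∈ (chartAt (EuclideanSpace ℝ (Fin n)) p).source) :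
    (extChartAt (𝓡 n) p).symm (extChartAt (𝓡 n) p x) = x :=
  (extChartAt (𝓡 n) p).left_inv (by rwa [extChartAt_source])

variable {J : Set ℝ} {O : Set M} {p : M}

theorem contMDiffOn_slice {w : ℝ → M → ℝ} {t : ℝ} (ht : t ∈ J)
    (hw : ContMDiffOn (𝓘(ℝ, ℝ).prod (𝓡 n)) 𝓘(ℝ, ℝ) ∞ (fun q : ℝ × M => w q.1 q.2) (J ×ˢ O)) :
    ContMDiffOn (𝓡 n) 𝓘(ℝ, ℝ) ∞ (w t) O :=
  hw.comp (g := fun q : ℝ × M => w q.1 q.2) (f := fun x => (t, x))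
    (contMDiffOn_const.prodMk contMDiffOn_id) fun _ hx => ⟨ht, hx⟩

theorem chartImage_mem_source {q : ↥(J ×ˢ chartImage n p O)} :
    (extChartAt (𝓡 n) p).symm q.1.2 ∈ (chartAt (EuclideanSpace ℝ (Fin n)) p).source :=
  extChartAt_symm_mem_source q.2.2.1

theorem extChartAt_chartImage (q : ↥(J ×ˢ chartImage n p O)) :
    extChartAt (𝓡 n) p ((extChartAt (𝓡 n) p).symm q.1.2) = q.1.2 :=
  (extChartAt (𝓡 n) p).right_inv q.2.2.1

variable [IsManifold (𝓡 n) ∞ M]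

theorem contMDiffOn_prod_extChartAt_symm :
    ContMDiffOn 𝓘(ℝ, ℝ × EuclideanSpace ℝ (Fin n)) (𝓘(ℝ, ℝ).prod (𝓡 n)) ∞
      (fun q : ℝ × EuclideanSpace ℝ (Fin n) => (q.1, (extChartAt (𝓡 n) p).symm q.2))
      (J ×ˢ chartImage n p O) :=
  (contDiff_fst.contMDiff.contMDiffOn).prodMk
    ((contMDiffOn_extChartAt_symm p).comp contDiff_snd.contMDiff.contMDiffOn
      fun _ hq => hq.2.1)

theorem contDiffOn_localFun {w : ℝ → M → ℝ}
    (hw : ContMDiffOn (𝓘(ℝ, ℝ).prod (𝓡 n)) 𝓘(ℝ, ℝ) ∞ (fun q : ℝ × M => w q.1 q.2) (J ×ˢ O)) :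
    ContDiffOn ℝ ∞ (fun q : ℝ × EuclideanSpace ℝ (Fin n) => localFun (w q.1) p q.2)
      (J ×ˢ chartImage n p O) :=
  contMDiffOn_iff_contDiffOn.1
    (hw.comp contMDiffOn_prod_extChartAt_symm fun _ hq => ⟨hq.1, hq.2.2⟩)

/-- The way back from the ring to the manifold: a function with a representative in `smoothRing` is
smooth. Smoothness of `v` and of all intermediate quantities is obtained in this way. -/
theorem contMDiffOn_of_localFun (hOp : O ⊆ (chartAt (EuclideanSpace ℝ (Fin n)) p).source)
    {w : ℝ → M → ℝ} (φ : smoothRing (J ×ˢ chartImage n p O))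
    (hφ : ∀ q, ev q φ = localFun (w q.1.1) p q.1.2) :
    ContMDiffOn (𝓘(ℝ, ℝ).prod (𝓡 n)) 𝓘(ℝ, ℝ) ∞ (fun q : ℝ × M => w q.1 q.2) (J ×ˢ O) := by
  have h1 : ContMDiffOn (𝓘(ℝ, ℝ).prod (𝓡 n)) 𝓘(ℝ, ℝ × EuclideanSpace ℝ (Fin n)) ∞
      (fun q : ℝ × M => (q.1, extChartAt (𝓡 n) p q.2)) (J ×ˢ O) :=
    contMDiff_fst.contMDiffOn.prodMk_space
      ((contMDiffOn_extChartAt (x := p)).comp contMDiff_snd.contMDiffOn fun _ hq => hOp hq.2)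
  have h2 : MapsTo (fun q : ℝ × M => (q.1, extChartAt (𝓡 n) p q.2)) (J ×ˢ O)
      (J ×ˢ chartImage n p O) := fun q hq => ⟨hq.1, extChartAt_mem_chartImage hq.2 (hOp hq.2)⟩
  refine ((contMDiffOn_iff_contDiffOn.2 (contDiffOn_coe φ)).comp h1 h2).congr fun q hq => ?_
  have h3 := hφ ⟨_, h2 hq⟩
  rw [ev_apply, ← zeroExtend_apply φ.1] at h3
  simp only [localFun, extChartAt_symm_extChartAt (hOp hq.2)] at h3
  exact h3.symm

theorem contMDiffOn_chartVec (p : M) (i : Fin n) :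
    ContMDiffOn (𝓡 n) ((𝓡 n).prod 𝓘(ℝ, EuclideanSpace ℝ (Fin n))) ∞
      (fun x : M => TotalSpace.mk' (EuclideanSpace ℝ (Fin n)) (E := fun x : M => TangentSpace (𝓡 n) x)
        x (chartVec p i x)) (chartAt (EuclideanSpace ℝ (Fin n)) p).source := by
  intro x hx
  have hb := mem_baseSet_of_mem_source hx
  have h1 := (trivializationAt (EuclideanSpace ℝ (Fin n)) (TangentSpace (𝓡 n)) p).contMDiffOn_symm
    (IB := 𝓡 n) (n := ∞)
  have h2 : ContMDiffOn (𝓡 n) ((𝓡 n).prod 𝓘(ℝ, EuclideanSpace ℝ (Fin n))) ∞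
      (fun x : M => (x, EuclideanSpace.single i (1 : ℝ)))
      (chartAt (EuclideanSpace ℝ (Fin n)) p).source :=
    contMDiffOn_id.prodMk contMDiffOn_const
  refine ((h1.comp h2 ?_).congr ?_) x hx
  · intro z hz
    rw [mem_preimage, Trivialization.mem_target]
    exact mem_baseSet_of_mem_source hz
  · intro z hz
    have hz' := mem_baseSet_of_mem_source hz
    rw [Function.comp_apply, ← Trivialization.mk_symm _ hz']
    unfold chartVec
    rw [Trivialization.symmL_apply _ hz']

theorem contDiffOn_localTensor {A : ℝ → TwoTensor n M} (hA : SmoothTensorOn J A)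
    (i j : Fin n) :
    ContDiffOn ℝ ∞ (fun q : ℝ × EuclideanSpace ℝ (Fin n) => localTensor (A q.1) p q.2 i j)
      (J ×ˢ chartImage n p O) := by
  have hs := contMDiffOn_prod_extChartAt_symm (n := n) (J := J) (O := O) (p := p)
  have hmaps : MapsTo (fun q : ℝ × EuclideanSpace ℝ (Fin n) => (extChartAt (𝓡 n) p).symm q.2)
      (J ×ˢ chartImage n p O) (chartAt (EuclideanSpace ℝ (Fin n)) p).source :=
    fun q hq => extChartAt_symm_mem_source hq.2.1
  have hs2 : ContMDiffOn 𝓘(ℝ, ℝ × EuclideanSpace ℝ (Fin n)) (𝓡 n) ∞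
      (fun q : ℝ × EuclideanSpace ℝ (Fin n) => (extChartAt (𝓡 n) p).symm q.2)
      (J ×ˢ chartImage n p O) :=
    (contMDiffOn_extChartAt_symm p).comp contDiff_snd.contMDiff.contMDiffOn fun _ hq => hq.2.1
  have hv := fun i => (contMDiffOn_chartVec p i).comp hs2 hmaps
  have hA' := hA.comp hs fun _ hq => ⟨hq.1, mem_univ _⟩
  have h : ContMDiffOn 𝓘(ℝ, ℝ × EuclideanSpace ℝ (Fin n)) ((𝓡 n).prod 𝓘(ℝ, ℝ)) ∞
      (fun q : ℝ × EuclideanSpace ℝ (Fin n) => TotalSpace.mk' ℝ (E := Bundle.Trivial M ℝ)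
        ((extChartAt (𝓡 n) p).symm q.2) (A q.1 ((extChartAt (𝓡 n) p).symm q.2)
          (chartVec p i ((extChartAt (𝓡 n) p).symm q.2))
          (chartVec p j ((extChartAt (𝓡 n) p).symm q.2)))) (J ×ˢ chartImage n p O) := by
    apply ContMDiffOn.clm_bundle_apply₂ (F₁ := EuclideanSpace ℝ (Fin n))
      (F₂ := EuclideanSpace ℝ (Fin n))
    · exact hA'
    · exact hv i
    · exact hv j
  refine contMDiffOn_iff_contDiffOn.1 fun q hq => ?_
  have h' := h q hq
  simp only [contMDiffWithinAt_totalSpace] at h'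
  refine h'.2.congr (fun z hz => ?_) ?_
  · exact localTensor_eq_chartVec _ hz.2.1 i j
  · exact localTensor_eq_chartVec _ hq.2.1 i j

/-! ### The local metric -/

theorem exists_represents (hJ : UniqueDiffOn ℝ J) (hJ' : J ⊆ closure (interior J)) (hO : IsOpen O)
    (p : M) (g : ℝ → ContMDiffRiemannianMetric (𝓡 n) ∞ (EuclideanSpace ℝ (Fin n))
      (fun x : M => TangentSpace (𝓡 n) x)) (hg : SmoothTensorOn J (fun t => (g t).inner)) :
    ∃ 𝔤 : AlgMetric (Fin n) (smoothRing (J ×ˢ chartImage n p O)),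
      Represents hJ (isOpen_chartImage p hO) 𝔤 (fun t y => localTensor (g t).inner p y) := by
  let G : Matrix (Fin n) (Fin n) (smoothRing (J ×ˢ chartImage n p O)) :=
    Matrix.of fun i j => mk (fun q => localTensor (g q.1).inner p q.2 i j)
      (contDiffOn_localTensor hg i j)
  have hG : Gᵀ = G := by
    ext1 i j
    refine ext_ev fun q => ?_
    have h := localTensor_metric_symm (g q.1.1) (chartImage_mem_source (q := q))
    rw [extChartAt_chartImage] at h
    exact congrFun (congrFun h i) j
  have hdet : IsUnit G.det := by
    refine isUnit_of_ev_ne_zero fun q => ?_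
    have h := isUnit_localTensor_metric (g q.1.1) (chartImage_mem_source (q := q))
    rw [extChartAt_chartImage, Matrix.isUnit_iff_isUnit_det] at h
    rw [AlgHom.map_det]
    exact h.ne_zero
  exact ⟨spaceTimeMetric hJ hJ' (isOpen_chartImage p hO) G hG hdet,
    fun _ => rfl, fun _ _ _ => rfl⟩

/-- Smoothness of `a` and `b` comes from their representatives, so the lemma can be iterated on
brackets of brackets. -/
theorem ev_bracket {hJ : UniqueDiffOn ℝ J} {hO : IsOpen O}
    {g : ℝ → ContMDiffRiemannianMetric (𝓡 n) ∞ (EuclideanSpace ℝ (Fin n))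
      (fun x : M => TangentSpace (𝓡 n) x)}
    {𝔤 : AlgMetric (Fin n) (smoothRing (J ×ˢ chartImage n p O))}
    (h : Represents hJ (isOpen_chartImage p hO) 𝔤 (fun t y => localTensor (g t).inner p y))
    (hOp : O ⊆ (chartAt (EuclideanSpace ℝ (Fin n)) p).source)
    {a b : ℝ → M → ℝ} {φ ψ : smoothRing (J ×ˢ chartImage n p O)}
    (hφ : ∀ q, ev q φ = localFun (a q.1.1) p q.1.2) (hψ : ∀ q, ev q ψ = localFun (b q.1.1) p q.1.2)
    (q : ↥(J ×ˢ chartImage n p O)) :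
    ev q (𝔤.bracket φ ψ) = localFun (fun x => (g q.1.1).inner x
      (riemGradient (g q.1.1).inner (a q.1.1) x) (riemGradient (g q.1.1).inner (b q.1.1) x)) p q.1.2 := by
  have hm : ∀ {a : ℝ → M → ℝ} {φ : smoothRing (J ×ˢ chartImage n p O)},
      (∀ q, ev q φ = localFun (a q.1.1) p q.1.2) →
      MDifferentiableAt (𝓡 n) 𝓘(ℝ, ℝ) (a q.1.1) ((extChartAt (𝓡 n) p).symm q.1.2) :=
    fun {a φ} h => ((contMDiffOn_slice q.2.1 (contMDiffOn_of_localFun hOp φ h)).contMDiffAt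
      (hO.mem_nhds q.2.2.2)).mdifferentiableAt (by simp)
  simp only [localFun]
  rw [metric_riemGradient_riemGradient (g q.1.1) (chartImage_mem_source (q := q)) (hm hφ) (hm hψ),
    extChartAt_chartImage]
  simp only [AlgMetric.bracket, AlgMetric.grad, AlgMetric.d, Matrix.mulVec, dotProduct, map_sum,
    map_mul, h.H_eq, h.partialDeriv_eq (W := fun t => localFun (a t) p) hφ,
    h.partialDeriv_eq (W := fun t => localFun (b t) p) hψ]

/-- The Hessian in coordinates in terms of the inner products of gradients. -/
theorem two_mul_coordHess (g : ContMDiffRiemannianMetric (𝓡 n) ∞ (EuclideanSpace ℝ (Fin n))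
      (fun x : M => TangentSpace (𝓡 n) x)) (hO : IsOpen O)
    (hOp : O ⊆ (chartAt (EuclideanSpace ℝ (Fin n)) p).source) {f a b : M → ℝ}
    (hf : ContMDiffOn (𝓡 n) 𝓘(ℝ, ℝ) ∞ f O) (ha : ContMDiffOn (𝓡 n) 𝓘(ℝ, ℝ) ∞ a O)
    (hb : ContMDiffOn (𝓡 n) 𝓘(ℝ, ℝ) ∞ b O) {x : M} (hx : x ∈ O)
    {ι : (M → ℝ) → (M → ℝ) → M → ℝ} (hι : ∀ a b x, ι a b x =
      g.inner x (riemGradient g.inner a x) (riemGradient g.inner b x)) :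
    2 * (((localTensor g.inner p (extChartAt (𝓡 n) p x))⁻¹ *ᵥ
        fun i => partialDeriv i (localFun a p) (extChartAt (𝓡 n) p x)) ⬝ᵥ
      (coordHess (localTensor g.inner p) (localFun f p) (extChartAt (𝓡 n) p x) *ᵥ
        ((localTensor g.inner p (extChartAt (𝓡 n) p x))⁻¹ *ᵥ
          fun i => partialDeriv i (localFun b p) (extChartAt (𝓡 n) p x)))) =
    ι b (ι f a) x + ι a (ι f b) x - ι f (ι a b) x := by
  -- A fixed metric is treated as a constant family over all times, so that the space-time ring
  -- applies.
  have hg : SmoothTensorOn univ (fun _ : ℝ => g.inner) :=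
    (g.contMDiff.comp contMDiff_snd).contMDiffOn
  obtain ⟨𝔤, h𝔤⟩ := exists_represents uniqueDiffOn_univ (by simp) hO p (fun _ => g) hg
  have hcomp : ∀ {c : M → ℝ}, ContMDiffOn (𝓡 n) 𝓘(ℝ, ℝ) ∞ c O →
      ContMDiffOn (𝓘(ℝ, ℝ).prod (𝓡 n)) 𝓘(ℝ, ℝ) ∞ (fun q : ℝ × M => c q.2) (univ ×ˢ O) :=
    fun hc => hc.comp contMDiff_snd.contMDiffOn fun _ hq => hq.2
  let lift (c : M → ℝ) (hc : ContMDiffOn (𝓡 n) 𝓘(ℝ, ℝ) ∞ c O) :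
      smoothRing ((univ : Set ℝ) ×ˢ chartImage n p O) :=
    mk (fun q => localFun c p q.2) (contDiffOn_localFun (w := fun _ => c) (hcomp hc))
  have hl : ∀ (c : M → ℝ) (hc : ContMDiffOn (𝓡 n) 𝓘(ℝ, ℝ) ∞ c O)
      (q : ↥((univ : Set ℝ) ×ˢ chartImage n p O)), ev q (lift c hc) = localFun c p q.1.2 :=
    fun _ _ _ => rfl
  have hbr : ∀ {c d : M → ℝ} {φ ψ : smoothRing ((univ : Set ℝ) ×ˢ chartImage n p O)},
      (∀ q, ev q φ = localFun c p q.1.2) → (∀ q, ev q ψ = localFun d p q.1.2) →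
      ∀ q, ev q (𝔤.bracket φ ψ) = localFun (ι c d) p q.1.2 := by
    intro c d φ ψ hφ hψ q
    rw [ev_bracket (hO := hO) h𝔤 hOp (a := fun _ => c) (b := fun _ => d) hφ hψ q]
    exact (hι c d _).symm
  let q : ↥((univ : Set ℝ) ×ˢ chartImage n p O) :=
    ⟨(0, extChartAt (𝓡 n) p x), mem_univ _, extChartAt_mem_chartImage hx (hOp hx)⟩
  have key := congrArg (ev q) (𝔤.two_mul_hess (lift f hf) (lift a ha) (lift b hb))
  rw [map_sub, map_add, hbr (hl b hb) (hbr (hl f hf) (hl a ha)),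
    hbr (hl a ha) (hbr (hl f hf) (hl b hb)), hbr (hl f hf) (hbr (hl a ha) (hl b hb))] at key
  simp only [localFun, q, extChartAt_symm_extChartAt (hOp hx)] at key
  rw [← key]
  have hgrad : ∀ (c : M → ℝ) (hc : ContMDiffOn (𝓡 n) 𝓘(ℝ, ℝ) ∞ c O) (i : Fin n),
      ev q (𝔤.grad (lift c hc) i) = ((localTensor g.inner p (extChartAt (𝓡 n) p x))⁻¹ *ᵥ
        fun i => partialDeriv i (localFun c p) (extChartAt (𝓡 n) p x)) i := by
    intro c hc i
    simp only [AlgMetric.grad, AlgMetric.d, Matrix.mulVec, dotProduct, map_sum,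
      map_mul, h𝔤.H_eq, h𝔤.partialDeriv_eq (W := fun _ => localFun c p) (hl c hc)]
    rfl
  have hhess : ∀ i j, ev q (𝔤.hess (lift f hf) i j) =
      coordHess (localTensor g.inner p) (localFun f p) (extChartAt (𝓡 n) p x) i j :=
    h𝔤.hess_eq (W := fun _ => localFun f p) (hl f hf) q
  rw [map_mul, map_ofNat, dotProduct, dotProduct, map_sum]
  congr 1
  refine Finset.sum_congr rfl fun i _ => ?_
  have hm : ev q ((𝔤.hess (lift f hf) *ᵥ 𝔤.grad (lift b hb)) i)
      = ∑ j, ev q (𝔤.hess (lift f hf) i j) * ev q (𝔤.grad (lift b hb) j) := by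
    simp only [Matrix.mulVec, dotProduct, map_sum, map_mul]
  simp only [hhess, hgrad] at hm
  have ha' := hgrad a ha i
  rw [map_mul, ← ha']
  exact congrArg _ hm.symm

/-! ### Chart independence -/

variable (g : ContMDiffRiemannianMetric (𝓡 n) ∞ (EuclideanSpace ℝ (Fin n))
      (fun x : M => TangentSpace (𝓡 n) x))

theorem inv_localTensor_metric_symm {x : M}
    (hp : x ∈ (chartAt (EuclideanSpace ℝ (Fin n)) p).source) :
    ((localTensor g.inner p (extChartAt (𝓡 n) p x))⁻¹)ᵀ =
      (localTensor g.inner p (extChartAt (𝓡 n) p x))⁻¹ := by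
  rw [Matrix.transpose_nonsing_inv, localTensor_metric_symm g hp]

theorem coordTrace_eq_trace {G : Matrix (Fin n) (Fin n) ℝ} (hG : (G⁻¹)ᵀ = G⁻¹)
    (A : Matrix (Fin n) (Fin n) ℝ) : coordTrace G A = (G⁻¹ * A).trace := by
  rw [← hG]
  simp only [coordTrace, Matrix.trace, Matrix.diag, Matrix.mul_apply, Matrix.transpose_apply]
  exact Finset.sum_comm

/-- With `B` the Jacobian, `localTensor_change` turns `G_p G_p⁻¹ = 1` into `Bᵀ (G_q B G_p⁻¹) = 1`. A
one-sided inverse of a square matrix is two-sided, so the factors may be exchanged. -/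
theorem jacobian_mul_inv {x q : M} (hp : x ∈ (chartAt (EuclideanSpace ℝ (Fin n)) p).source)
    (hq : x ∈ (chartAt (EuclideanSpace ℝ (Fin n)) q).source) :
    chartJacobian p q x * (localTensor g.inner p (extChartAt (𝓡 n) p x))⁻¹ * (chartJacobian p q x)ᵀ
      = (localTensor g.inner q (extChartAt (𝓡 n) q x))⁻¹ := by
  have hu := (Matrix.isUnit_iff_isUnit_det _).1 (isUnit_localTensor_metric g hp)
  have h1 : (chartJacobian p q x)ᵀ * (localTensor g.inner q (extChartAt (𝓡 n) q x) *
      chartJacobian p q x * (localTensor g.inner p (extChartAt (𝓡 n) p x))⁻¹) = 1 := by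
    have h := Matrix.mul_nonsing_inv _ hu
    conv_lhs at h => enter [1]; rw [localTensor_change g.inner hp hq]
    rw [← h]
    simp only [mul_assoc]
  have h2 := mul_eq_one_comm.1 h1
  symm
  apply Matrix.inv_eq_right_inv
  rw [← h2]
  simp only [mul_assoc]

/-- The trace is given by the components in any chart. -/
theorem traceOf_eq (A : TwoTensor n M) {x : M}
    (hp : x ∈ (chartAt (EuclideanSpace ℝ (Fin n)) p).source) :
    traceOf g.inner A x = coordTrace (localTensor g.inner p (extChartAt (𝓡 n) p x))
      (localTensor A p (extChartAt (𝓡 n) p x)) := by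
  have hx : x ∈ (chartAt (EuclideanSpace ℝ (Fin n)) x).source := mem_chart_source _ x
  rw [traceOf, tensorAt, tensorAt, coordTrace_eq_trace (inv_localTensor_metric_symm g hx),
    coordTrace_eq_trace (inv_localTensor_metric_symm g hp), ← jacobian_mul_inv g hp hx,
    localTensor_change A hp hx, mul_assoc, mul_assoc, Matrix.trace_mul_comm]
  simp only [mul_assoc]

theorem mvfderiv_chart_component {x q : M} (hq : x ∈ (chartAt (EuclideanSpace ℝ (Fin n)) q).source)
    (c : Fin n) (V : TangentSpace (𝓡 n) x) :
    mvfderiv (𝓡 n) (fun z => extChartAt (𝓡 n) q z c) x V = chartCoord q x V c := by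
  have h1 : MDifferentiableAt (𝓡 n) 𝓘(ℝ, EuclideanSpace ℝ (Fin n)) (extChartAt (𝓡 n) q) x :=
    mdifferentiableAt_extChartAt hq
  have h2 := mvfderiv_comp_apply x (g := (EuclideanSpace.proj c : EuclideanSpace ℝ (Fin n) →L[ℝ] ℝ))
    (ContinuousLinearMap.mdifferentiableAt _) h1 V
  rw [chartCoord_eq_mvfderiv hq]
  refine h2.trans ?_
  rw [mvfderiv, mfderiv_eq_fderiv, ContinuousLinearMap.fderiv]
  rfl

/-- The Laplacian is given by the coordinate expression in any chart. -/
theorem laplaceBeltrami_eq {f : M → ℝ} (hO : IsOpen O) (hf : ContMDiffOn (𝓡 n) 𝓘(ℝ, ℝ) ∞ f O) {x : M}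
    (hx : x ∈ O) (hp : x ∈ (chartAt (EuclideanSpace ℝ (Fin n)) p).source) :
    laplaceBeltrami g.inner f x = coordTrace (localTensor g.inner p (extChartAt (𝓡 n) p x))
      (coordHess (localTensor g.inner p) (localFun f p) (extChartAt (𝓡 n) p x)) := by
  have hq : x ∈ (chartAt (EuclideanSpace ℝ (Fin n)) x).source := mem_chart_source _ x
  -- On this overlap the coordinate functions of the chart at `x` serve as test functions in both
  -- charts.
  set V : Set M := O ∩ ((chartAt (EuclideanSpace ℝ (Fin n)) p).source ∩
    (chartAt (EuclideanSpace ℝ (Fin n)) x).source) with hV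
  have hVo : IsOpen V := hO.inter
    ((chartAt (EuclideanSpace ℝ (Fin n)) p).open_source.inter
      (chartAt (EuclideanSpace ℝ (Fin n)) x).open_source)
  have hxV : x ∈ V := ⟨hx, hp, hq⟩
  have hfV : ContMDiffOn (𝓡 n) 𝓘(ℝ, ℝ) ∞ f V := hf.mono inter_subset_left
  have hc : ∀ c : Fin n, ContMDiffOn (𝓡 n) 𝓘(ℝ, ℝ) ∞ (fun z => extChartAt (𝓡 n) x z c) V := fun c =>
    (EuclideanSpace.proj c : EuclideanSpace ℝ (Fin n) →L[ℝ] ℝ).contMDiff.comp_contMDiffOn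
      ((contMDiffOn_extChartAt (x := x)).mono fun _ hz => hz.2.2)
  have hd : ∀ {r : M} (_ : x ∈ (chartAt (EuclideanSpace ℝ (Fin n)) r).source) (c i : Fin n),
      partialDeriv i (localFun (fun z => extChartAt (𝓡 n) x z c) r) (extChartAt (𝓡 n) r x)
        = chartJacobian r x x c i := fun hr c i => by
    rw [← mvfderiv_chartVec hr (((hc c).contMDiffAt (hVo.mem_nhds hxV)).mdifferentiableAt (by simp)),
      mvfderiv_chart_component hq]
    rfl
  have hJ1 : (chartJacobian x x x : Matrix (Fin n) (Fin n) ℝ) = 1 := by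
    ext c i
    rw [chartJacobian, Matrix.of_apply, chartCoord_chartVec hq]
    simp [Matrix.one_apply]
  set B : Matrix (Fin n) (Fin n) ℝ := chartJacobian p x x with hB
  set Hp := (localTensor g.inner p (extChartAt (𝓡 n) p x))⁻¹ with hHp
  set Hx := (localTensor g.inner x (extChartAt (𝓡 n) x x))⁻¹ with hHx
  set Kp := coordHess (localTensor g.inner p) (localFun f p) (extChartAt (𝓡 n) p x) with hKp
  set Kx := coordHess (localTensor g.inner x) (localFun f x) (extChartAt (𝓡 n) x x) with hKx
  have hHps : Hpᵀ = Hp := inv_localTensor_metric_symm g hp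
  have hHxs : Hxᵀ = Hx := inv_localTensor_metric_symm g hq
  -- Both Hessians are tested on the gradients of the coordinate functions with indices `c` and `d`.
  -- The two values of `two_mul_coordHess` agree, as its right side is free of charts. The
  -- differentials are rows of `B` in the chart at `p` and rows of the identity in the chart at `x`.
  have key : B * Hp * Kp * Hp * Bᵀ = Hx * Kx * Hx := by
    ext c d
    have e1 := two_mul_coordHess g hVo (p := p) (fun _ hz => hz.2.1) hfV (hc c) (hc d) hxV
      (ι := fun a b x => g.inner x (riemGradient g.inner a x) (riemGradient g.inner b x))
      (fun _ _ _ => rfl)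
    have e2 := two_mul_coordHess g hVo (p := x) (fun _ hz => hz.2.2) hfV (hc c) (hc d) hxV
      (ι := fun a b x => g.inner x (riemGradient g.inner a x) (riemGradient g.inner b x))
      (fun _ _ _ => rfl)
    have e3 := mul_left_cancel₀ two_ne_zero (e1.trans e2.symm)
    simp only [hd hp, hd hq, hJ1] at e3
    have e4 : ∀ (B H K : Matrix (Fin n) (Fin n) ℝ) (_ : Hᵀ = H) (c d : Fin n),
        (H *ᵥ fun i => B c i) ⬝ᵥ (K *ᵥ (H *ᵥ fun i => B d i)) = (B * H * K * H * Bᵀ) c d := by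
      intro B H K hH c d
      have e5 : ∀ c, (H *ᵥ fun i => B c i) = fun i => (B * H) c i := fun c => by
        ext i
        simp only [Matrix.mulVec, dotProduct, Matrix.mul_apply]
        refine Finset.sum_congr rfl fun j _ => ?_
        rw [mul_comm, ← congrFun (congrFun hH i) j, Matrix.transpose_apply]
      have e6 : B * H * K * H * Bᵀ = (B * H) * (K * (B * H)ᵀ) := by
        rw [Matrix.transpose_mul, hH]
        simp only [mul_assoc]
      rw [e5, e5, e6]
      rfl
    rw [e4 _ _ _ hHps, e4 _ _ _ hHxs] at e3
    rw [one_mul, Matrix.transpose_one, mul_one] at e3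
    exact e3
  have hGx : localTensor g.inner x (extChartAt (𝓡 n) x x) * Hx = 1 :=
    Matrix.mul_nonsing_inv _ ((Matrix.isUnit_iff_isUnit_det _).1 (isUnit_localTensor_metric g hq))
  have hGp : localTensor g.inner p (extChartAt (𝓡 n) p x) * Hp = 1 :=
    Matrix.mul_nonsing_inv _ ((Matrix.isUnit_iff_isUnit_det _).1 (isUnit_localTensor_metric g hp))
  have hch := localTensor_change g.inner hp hq
  rw [laplaceBeltrami, tensorAt, hessAt, coordTrace_eq_trace hHxs, coordTrace_eq_trace hHps]
  -- Lowering both indices of the contravariant Hessian in `key` by the metric transfers the trace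
  -- from one chart to the other, the Jacobians being absorbed in `G_p = Bᵀ G_x B`.
  calc (Hx * Kx).trace
      = (localTensor g.inner x (extChartAt (𝓡 n) x x) * (Hx * Kx * Hx)).trace := by
        rw [mul_assoc Hx, ← mul_assoc _ Hx, hGx, one_mul, Matrix.trace_mul_comm]
    _ = (localTensor g.inner p (extChartAt (𝓡 n) p x) * (Hp * Kp * Hp)).trace := by
        rw [← key, hch, ← mul_assoc _ _ Bᵀ, Matrix.trace_mul_comm]
        simp only [mul_assoc]
        rfl
    _ = (Hp * Kp).trace := by
        rw [mul_assoc Hp, ← mul_assoc _ Hp, hGp, one_mul, Matrix.trace_mul_comm]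

end EvolvingMetric

/-! ### Exponentials and functions of time in the smooth ring. -/

namespace smoothRing

section

variable {F : Type*} [NormedAddCommGroup F] [NormedSpace ℝ F] {s : Set F}

/-- The exponential of a smooth function. -/
def exp (φ : smoothRing s) : smoothRing s :=
  mk (fun x => Real.exp (zeroExtend φ.1 x)) (contDiffOn_coe φ).exp

theorem ev_exp (φ : smoothRing s) (p : s) : ev p (exp φ) = Real.exp (ev p φ) := by
  rw [exp, ev_mk, zeroExtend_apply, ev_apply]

theorem dirDeriv_exp (hs : UniqueDiffOn ℝ s) (e : F) (φ : smoothRing s) :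
    dirDeriv hs e (exp φ) = exp φ * dirDeriv hs e φ := by
  refine ext_ev fun p => ?_
  have h1 := hasFDerivWithinAt (φ := exp φ) (Φ := fun x => Real.exp (zeroExtend φ.1 x))
    (fun _ => rfl) p
  have h2 := (differentiableWithinAt_coe φ p).hasFDerivWithinAt.exp
  rw [map_mul, ev_dirDeriv, (hs p p.2).eq h1 h2, ev_dirDeriv]
  rfl

end

section

variable {E : Type*} [NormedAddCommGroup E] [NormedSpace ℝ E] {J : Set ℝ} {U : Set E}

/-- A smooth function of time. -/
def ofTime (κ : ℝ → ℝ) (hκ : ContDiffOn ℝ ∞ κ J) : smoothRing (J ×ˢ U) :=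
  mk (fun q => κ q.1) (hκ.comp contDiffOn_fst fun _ hq => hq.1)

theorem dirDeriv_space_ofTime (hs : UniqueDiffOn ℝ (J ×ˢ U)) (hU : IsOpen U) {κ : ℝ → ℝ}
    (hκ : ContDiffOn ℝ ∞ κ J) (e : E) : dirDeriv hs (0, e) (ofTime (U := U) κ hκ) = 0 := by
  refine ext_ev fun p => ?_
  rw [← fderiv_space hs hU (W := fun t _ => κ t) (fun _ => rfl) p e]
  simp

theorem ev_dirDeriv_time_ofTime (hs : UniqueDiffOn ℝ (J ×ˢ U)) (hJ : UniqueDiffOn ℝ J) {κ : ℝ → ℝ}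
    (hκ : ContDiffOn ℝ ∞ κ J) (p : ↥(J ×ˢ U)) {κ' : ℝ} (h : HasDerivAt κ κ' p.1.1) :
    ev p (dirDeriv hs (1, 0) (ofTime (U := U) κ hκ)) = κ' :=
  (hJ p.1.1 p.2.1).eq_deriv _ (hasDerivWithinAt_time hs (W := fun t _ => κ t) (fun _ => rfl) p)
    h.hasDerivWithinAt

end

end smoothRing

/-! ### Intrinsic operators as evaluations of algebraic ones. -/

namespace EvolvingMetric

open smoothRing

variable {n : ℕ} {M : Type*} [TopologicalSpace M] [ChartedSpace (EuclideanSpace ℝ (Fin n)) M]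
  {O : Set M} {p : M}

theorem derivWithin_eq_ev {T : ℝ} (hs : UniqueDiffOn ℝ (Ico 0 T ×ˢ chartImage n p O)) {w : ℝ → M → ℝ}
    {φ : smoothRing (Ico 0 T ×ˢ chartImage n p O)}
    (hφ : ∀ q, ev q φ = localFun (w q.1.1) p q.1.2) (q : ↥(Ico 0 T ×ˢ chartImage n p O)) :
    derivWithin (fun s => w s ((extChartAt (𝓡 n) p).symm q.1.2)) (Ico 0 T) q.1.1 =
      ev q (dirDeriv hs (1, 0) φ) :=
  (hasDerivWithinAt_time hs (W := fun t => localFun (w t) p) hφ q).derivWithin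
    (uniqueDiffOn_Ico 0 T q.1.1 q.2.1)

variable [IsManifold (𝓡 n) ∞ M]

section

variable {J : Set ℝ} {hJ : UniqueDiffOn ℝ J} {hO : IsOpen O}
    {g : ℝ → ContMDiffRiemannianMetric (𝓡 n) ∞ (EuclideanSpace ℝ (Fin n))
      (fun x : M => TangentSpace (𝓡 n) x)}
    {𝔤 : AlgMetric (Fin n) (smoothRing (J ×ˢ chartImage n p O))}

/-- The identity holds throughout the chart image and not just at the centre of the chart, hence the
need for `laplaceBeltrami_eq`; only so can the result be differentiated again. -/
theorem ev_lap
    (h : Represents hJ (isOpen_chartImage p hO) 𝔤 (fun t y => localTensor (g t).inner p y))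
    (hOp : O ⊆ (chartAt (EuclideanSpace ℝ (Fin n)) p).source)
    {a : ℝ → M → ℝ} {φ : smoothRing (J ×ˢ chartImage n p O)}
    (hφ : ∀ q, ev q φ = localFun (a q.1.1) p q.1.2) (q : ↥(J ×ˢ chartImage n p O)) :
    ev q (𝔤.lap φ) = localFun (laplaceBeltrami (g q.1.1).inner (a q.1.1)) p q.1.2 := by
  rw [localFun, laplaceBeltrami_eq (g q.1.1) hO
    (contMDiffOn_slice q.2.1 (contMDiffOn_of_localFun hOp φ hφ)) q.2.2.2
    (chartImage_mem_source (q := q)), extChartAt_chartImage,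
    h.lap_eq (W := fun t => localFun (a t) p) hφ]

variable {α : ℝ → TwoTensor n M} {A : Matrix (Fin n) (Fin n) (smoothRing (J ×ˢ chartImage n p O))}

theorem ev_tr
    (h : Represents hJ (isOpen_chartImage p hO) 𝔤 (fun t y => localTensor (g t).inner p y))
    (hA : ∀ q i j, ev q (A i j) = localTensor (α q.1.1) p q.1.2 i j)
    (q : ↥(J ×ˢ chartImage n p O)) :
    ev q (𝔤.tr A) = localFun (traceOf (g q.1.1).inner (α q.1.1)) p q.1.2 := by
  rw [localFun, traceOf_eq (g q.1.1) _ (chartImage_mem_source (q := q)), extChartAt_chartImage,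
    h.tr_eq q (hA q)]

end

section

variable {T : ℝ} {hO : IsOpen O}
    {g : ℝ → ContMDiffRiemannianMetric (𝓡 n) ∞ (EuclideanSpace ℝ (Fin n))
      (fun x : M => TangentSpace (𝓡 n) x)}
    {𝔤 : AlgMetric (Fin n) (smoothRing (Ico 0 T ×ˢ chartImage n p O))}
    {α : ℝ → TwoTensor n M} {A : Matrix (Fin n) (Fin n) (smoothRing (Ico 0 T ×ˢ chartImage n p O))}

theorem ev_conjHeat (hs : UniqueDiffOn ℝ (Ico 0 T ×ˢ chartImage n p O))
    (h : Represents (uniqueDiffOn_Ico 0 T) (isOpen_chartImage p hO) 𝔤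
      (fun t y => localTensor (g t).inner p y))
    (hOp : O ⊆ (chartAt (EuclideanSpace ℝ (Fin n)) p).source)
    (hA : ∀ q i j, ev q (A i j) = localTensor (α q.1.1) p q.1.2 i j)
    {w : ℝ → M → ℝ} {φ : smoothRing (Ico 0 T ×ˢ chartImage n p O)}
    (hφ : ∀ q, ev q φ = localFun (w q.1.1) p q.1.2) (q : ↥(Ico 0 T ×ˢ chartImage n p O)) :
    ev q (-dirDeriv hs (1, 0) φ - 𝔤.lap φ + 𝔤.tr A * φ) =
      conjHeat T (fun s => (g s).inner) α w q.1.1 ((extChartAt (𝓡 n) p).symm q.1.2) := by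
  rw [conjHeat, derivWithin_eq_ev hs hφ, map_add, map_sub, map_neg, map_mul, ev_lap (hO := hO) h hOp hφ,
    ev_tr (hO := hO) h hA, hφ]
  rfl

/-- The chart is the one at `x` and the evaluation is at its centre. Ricci tensor, divergence and
norm are not differentiated, so there they match their definitions directly. -/
theorem ev_mueller {x : M} (hs : UniqueDiffOn ℝ (Ico 0 T ×ˢ chartImage n x O))
    {𝔤 : AlgMetric (Fin n) (smoothRing (Ico 0 T ×ˢ chartImage n x O))}
    {A : Matrix (Fin n) (Fin n) (smoothRing (Ico 0 T ×ˢ chartImage n x O))}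
    (h : Represents (uniqueDiffOn_Ico 0 T) (isOpen_chartImage x hO) 𝔤
      (fun t y => localTensor (g t).inner x y))
    (hOp : O ⊆ (chartAt (EuclideanSpace ℝ (Fin n)) x).source)
    (hA : ∀ q i j, ev q (A i j) = localTensor (α q.1.1) x q.1.2 i j)
    {f : ℝ → M → ℝ} {φ : smoothRing (Ico 0 T ×ˢ chartImage n x O)}
    (hφ : ∀ q, ev q φ = localFun (f q.1.1) x q.1.2) {t : ℝ} (ht : t ∈ Ico 0 T) (hx : x ∈ O) :
    ev (⟨(t, extChartAt (𝓡 n) x x), ht, extChartAt_mem_chartImage hx (mem_chart_source _ x)⟩ :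
        ↥(Ico 0 T ×ˢ chartImage n x O)) (𝔤.mueller (dirDeriv hs (1, 0)) A φ) =
      muellerD T (fun s => (g s).inner) α t x (riemGradient (g t).inner (f t) x) := by
  have hxs : x ∈ (chartAt (EuclideanSpace ℝ (Fin n)) x).source := mem_chart_source _ x
  set q : ↥(Ico 0 T ×ˢ chartImage n x O) :=
    ⟨(t, extChartAt (𝓡 n) x x), ht, extChartAt_mem_chartImage hx (mem_chart_source _ x)⟩ with hq
  have hsymm : (extChartAt (𝓡 n) x).symm q.1.2 = x := extChartAt_symm_extChartAt hxs
  have hf : MDifferentiableAt (𝓡 n) 𝓘(ℝ, ℝ) (f t) x :=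
    ((contMDiffOn_slice ht (contMDiffOn_of_localFun hOp φ hφ)).contMDiffAt
      (hO.mem_nhds hx)).mdifferentiableAt (by simp)
  have hS := ev_tr (hO := hO) h hA
  have hgrad : ∀ i, ev q (𝔤.grad φ i) = vecAt x (riemGradient (g t).inner (f t) x) i := by
    intro i
    rw [vecAt, ← chartCoord_eq_mvfderiv hxs, chartCoord_riemGradient (g t) hxs hf]
    simp only [AlgMetric.grad, AlgMetric.d, Matrix.mulVec, dotProduct, map_sum, map_mul, h.H_eq,
      h.partialDeriv_eq (W := fun t => localFun (f t) x) hφ]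
    rfl
  have h1 := derivWithin_eq_ev hs (w := fun s => traceOf (g s).inner (α s)) hS q
  have h2 := ev_lap (hO := hO) h hOp (a := fun s => traceOf (g s).inner (α s)) hS q
  have h3 := h.inner_eq q (hA q)
  have h4 := fun i j => h.ricci_eq q i j
  have h5 := fun k => h.div_eq (B := fun t y => localTensor (α t) x y) hA q k
  have h6 := ev_bracket (hO := hO) h hOp (a := fun s => traceOf (g s).inner (α s)) (b := f) hS hφ q
  rw [hsymm] at h1
  rw [localFun, hsymm] at h2 h6
  simp only [AlgMetric.mueller, map_add, map_sub, map_mul, map_sum, map_ofNat, Matrix.sub_apply,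
    hgrad, ← h1, h2, h3, h4, h5, h6, hA]
  rfl

end

/-- The Gram matrix of a tensor family in the chart at `p`. -/
def localMatrix (p : M) (O : Set M) {J : Set ℝ} {α : ℝ → TwoTensor n M} (hα : SmoothTensorOn J α) :
    Matrix (Fin n) (Fin n) (smoothRing (J ×ˢ chartImage n p O)) :=
  Matrix.of fun i j => mk (fun q => localTensor (α q.1) p q.2 i j) (contDiffOn_localTensor hα i j)

theorem SmoothTensorOn.mono {J J' : Set ℝ} {α : ℝ → TwoTensor n M} (h : SmoothTensorOn J α)
    (hJ : J' ⊆ J) : SmoothTensorOn J' α :=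
  ContMDiffOn.mono h (prod_mono hJ le_rfl)

/-- As a single exponential, `u` is smooth and is differentiated by `dirDeriv_exp`, without a rule
for real powers. -/
theorem density_eq_exp {c f : ℝ} (hc : 0 < c) (n : ℕ) :
    (4 * Real.pi * c) ^ (-(n : ℝ) / 2) * Real.exp (-f)
      = Real.exp (-(n : ℝ) / 2 * Real.log (4 * Real.pi * c) - f) := by
  rw [Real.rpow_def_of_pos (by positivity), ← Real.exp_add]
  ring_nf

/-- The evolution equation of the entropy density in a chart. -/
theorem entropyDensity_local {T : ℝ} (p : M) (hO : IsOpen O)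
    (hOp : O ⊆ (chartAt (EuclideanSpace ℝ (Fin n)) p).source)
    (g : ℝ → ContMDiffRiemannianMetric (𝓡 n) ∞ (EuclideanSpace ℝ (Fin n))
      (fun x : M => TangentSpace (𝓡 n) x))
    (α : ℝ → TwoTensor n M)
    (hg : SmoothTensorOn (Ico 0 T) (fun t => (g t).inner))
    (hα : SmoothTensorOn (Ico 0 T) α)
    (hα_symm : ∀ t ∈ Ico 0 T, ∀ (x : M) (X Y : TangentSpace (𝓡 n) x), α t x X Y = α t x Y X)
    (hflow : ∀ t ∈ Ico 0 T, ∀ (x : M) (X Y : TangentSpace (𝓡 n) x),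
      HasDerivWithinAt (fun s => (g s).inner x X Y) (-2 * α t x X Y) (Ico 0 T) t)
    (f u v : ℝ → M → ℝ)
    (hf : SmoothFunOn n (Ico 0 T) f)
    (hu : ∀ t ∈ Ico 0 T, ∀ x : M,
      u t x = (4 * Real.pi * (T - t)) ^ (-(n : ℝ) / 2) * Real.exp (-f t x))
    (hu_heat : ∀ t ∈ Ico 0 T, ∀ x : M, conjHeat T (fun s => (g s).inner) α u t x = 0)
    (hv : ∀ t ∈ Ico 0 T, ∀ x : M,
      v t x = ((T - t) * (2 * laplaceBeltrami (g t).inner (f t) x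
          - (g t).inner x (riemGradient (g t).inner (f t) x) (riemGradient (g t).inner (f t) x)
          + traceOf (g t).inner (α t) x) + f t x - n) * u t x)
    (hs : UniqueDiffOn ℝ (Ico 0 T ×ˢ chartImage n p O)) :
    ∃ (𝔤 : AlgMetric (Fin n) (smoothRing (Ico 0 T ×ˢ chartImage n p O)))
      (φ υ ψ τ σ : smoothRing (Ico 0 T ×ˢ chartImage n p O)),
      Represents (uniqueDiffOn_Ico 0 T) (isOpen_chartImage p hO) 𝔤
        (fun t y => localTensor (g t).inner p y) ∧
      (∀ q, ev q φ = localFun (f q.1.1) p q.1.2) ∧ (∀ q, ev q υ = localFun (u q.1.1) p q.1.2) ∧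
      (∀ q, ev q ψ = localFun (v q.1.1) p q.1.2) ∧ (∀ q, ev q τ = T - q.1.1) ∧
      (∀ q, ev q σ = 1 / (2 * (T - q.1.1))) ∧
      -dirDeriv hs (1, 0) ψ - 𝔤.lap ψ + 𝔤.tr (localMatrix p O hα) * ψ =
        -2 * τ * υ * 𝔤.inner (localMatrix p O hα + 𝔤.hess φ - σ • 𝔤.G)
            (localMatrix p O hα + 𝔤.hess φ - σ • 𝔤.G)
          - τ * υ * 𝔤.mueller (dirDeriv hs (1, 0)) (localMatrix p O hα) φ := by
  have hJ' : Ico 0 T ⊆ closure (interior (Ico 0 T)) := by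
    rcases le_or_gt T 0 with hT | hT
    · simp [Ico_eq_empty (not_lt.2 hT)]
    · rw [interior_Ico, closure_Ioo hT.ne]
      exact Ico_subset_Icc_self
  have hU := isOpen_chartImage (n := n) p hO
  obtain ⟨𝔤, h⟩ := exists_represents (uniqueDiffOn_Ico 0 T) hJ' hO p g hg
  have hτ0 : ∀ t ∈ Ico 0 T, T - t ≠ 0 := fun t ht => (sub_pos.2 ht.2).ne'
  have hlog0 : ∀ t ∈ Ico 0 T, 4 * Real.pi * (T - t) ≠ 0 := fun t ht =>
    mul_ne_zero (by positivity) (hτ0 t ht)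
  have hlin : ContDiff ℝ ∞ fun t : ℝ => T - t := contDiff_const.sub contDiff_id
  let φ : smoothRing (Ico 0 T ×ˢ chartImage n p O) :=
    mk (fun q => localFun (f q.1) p q.2) (contDiffOn_localFun (hf.mono (prod_mono le_rfl (subset_univ _))))
  let τ : smoothRing (Ico 0 T ×ˢ chartImage n p O) := ofTime (fun t => T - t) hlin.contDiffOn
  let σ : smoothRing (Ico 0 T ×ˢ chartImage n p O) := ofTime (fun t => 1 / (2 * (T - t)))
    (contDiffOn_const.div (contDiffOn_const.mul hlin.contDiffOn)
      fun t ht => mul_ne_zero two_ne_zero (hτ0 t ht))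
  have hlog : ContDiffOn ℝ ∞ (fun t => -(n : ℝ) / 2 * Real.log (4 * Real.pi * (T - t))) (Ico 0 T) :=
    contDiffOn_const.mul ((contDiffOn_const.mul hlin.contDiffOn).log hlog0)
  -- The logarithm of the normalizing factor `(4πτ)^(-n/2)`, so that `u = exp (lam - f)`.
  let lam : smoothRing (Ico 0 T ×ˢ chartImage n p O) := ofTime _ hlog
  set υ : smoothRing (Ico 0 T ×ˢ chartImage n p O) := exp (lam - φ) with hυdef
  set E := dirDeriv hs ((1 : ℝ), (0 : EuclideanSpace ℝ (Fin n))) with hE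
  set A := localMatrix p O hα with hAdef
  set P := τ * (2 * 𝔤.lap φ - 𝔤.bracket φ φ + 𝔤.tr A) + φ - (Fintype.card (Fin n) :
    smoothRing (Ico 0 T ×ˢ chartImage n p O)) with hP
  have hA : ∀ q i j, ev q (A i j) = localTensor (α q.1.1) p q.1.2 i j := fun _ _ _ => rfl
  have hφ : ∀ q, ev q φ = localFun (f q.1.1) p q.1.2 := fun _ => rfl
  have hτ : ∀ q, ev q τ = T - q.1.1 := fun _ => rfl
  have hσ : ∀ q, ev q σ = 1 / (2 * (T - q.1.1)) := fun _ => rfl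
  have hυ : ∀ q, ev q υ = localFun (u q.1.1) p q.1.2 := fun q => by
    rw [hυdef, ev_exp, map_sub, localFun, hu _ q.2.1, density_eq_exp (sub_pos.2 q.2.1.2)]
    rfl
  have hψ : ∀ q, ev q (P * υ) = localFun (v q.1.1) p q.1.2 := fun q => by
    have h1 := ev_lap (hO := hO) h hOp (a := f) hφ q
    have h2 := ev_bracket (hO := hO) h hOp (a := f) (b := f) hφ hφ q
    have h3 := ev_tr (hO := hO) h hA q
    rw [map_mul, hυ, localFun, localFun, hv _ q.2.1, hP]
    simp only [map_add, map_sub, map_mul, map_ofNat, map_natCast, h1, h2, h3, hφ, hτ, localFun,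
      Fintype.card_fin]
  have hD : ∀ (i : Fin n) {κ : ℝ → ℝ} (hκ : ContDiffOn ℝ ∞ κ (Ico 0 T)),
      𝔤.D i (ofTime κ hκ) = 0 := fun i κ hκ => by
    rw [h.D_eq]
    exact dirDeriv_space_ofTime _ hU hκ _
  refine ⟨𝔤, φ, υ, P * υ, τ, σ, h, hφ, hυ, hψ, hτ, hσ, ?_⟩
  refine 𝔤.conjHeat_entropyDensity ?_ ?_ ?_ ?_ ?_ ?_ (fun i => hD i _) ?_ (fun i => hD i _) ?_ ?_ hP
  · ext1 i j
    exact ext_ev fun q => hα_symm _ q.2.1 _ _ _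
  · intro i F
    rw [h.D_eq]
    exact dirDeriv_comm _ (prod_subset_closure_interior hJ' hU) _ _ F
  · ext1 i j
    refine ext_ev fun q => ?_
    have h1 := hasDerivWithinAt_time hs (W := fun t y => localTensor (g t).inner p y i j)
      (fun q => h.G_eq q i j) q
    have h2 := hflow _ q.2.1 ((extChartAt (𝓡 n) p).symm q.1.2) (coordVec p i q.1.2)
      (coordVec p j q.1.2)
    rw [Matrix.map_apply, (uniqueDiffOn_Ico 0 T q.1.1 q.2.1).eq_deriv _ h1 h2, Matrix.smul_apply,
      smul_eq_mul, map_mul, map_neg, map_ofNat]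
    rfl
  · intro i
    have h1 : 𝔤.D i υ = υ * 𝔤.D i (lam - φ) := by
      rw [h.D_eq]
      exact dirDeriv_exp _ _ _
    rw [h1, map_sub, hD]
    ring
  · exact isUnit_of_ev_ne_zero fun q => by rw [hυdef, ev_exp]; exact (Real.exp_pos _).ne'
  · have h1 : E lam = Fintype.card (Fin n) * σ := by
      refine ext_ev fun q => ?_
      -- The derivative is `n/(2τ) = n σ`, the source of the term `n σ` in `∂f/∂t`.
      have h2 : HasDerivAt (fun t => -(n : ℝ) / 2 * Real.log (4 * Real.pi * (T - t)))
          (n * (1 / (2 * (T - q.1.1)))) q.1.1 := by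
        have h3 := (((hasDerivAt_id' q.1.1).const_sub T).const_mul (4 * Real.pi)).log (hlog0 _ q.2.1)
        refine (h3.const_mul (-(n : ℝ) / 2)).congr_deriv ?_
        have := hτ0 _ q.2.1
        have := Real.pi_ne_zero
        field_simp
      rw [hE, ev_dirDeriv_time_ofTime hs (uniqueDiffOn_Ico 0 T) _ q h2, map_mul, map_natCast,
        hσ, Fintype.card_fin]
    rw [hυdef, hE, dirDeriv_exp, map_sub, ← hE, h1]
  · refine ext_ev fun q => ?_
    rw [hE, ev_dirDeriv_time_ofTime hs (uniqueDiffOn_Ico 0 T) _ q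
      ((hasDerivAt_id' q.1.1).const_sub T), map_neg, map_one]
  · refine ext_ev fun q => ?_
    rw [map_mul, map_mul, map_ofNat, map_one, hτ, hσ]
    have := hτ0 _ q.2.1
    field_simp
  · refine ext_ev fun q => ?_
    rw [ev_conjHeat (hO := hO) hs h hOp hA hυ, hu_heat _ q.2.1, map_zero]

end EvolvingMetric

end

end

/-! ### From charts to the manifold. -/

theorem theorem1p1 {n : ℕ} {M : Type*} [TopologicalSpace M] [T2Space M] [CompactSpace M]
    [ChartedSpace (EuclideanSpace ℝ (Fin n)) M] [IsManifold (𝓡 n) ∞ M]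
    {T : ℝ} (hT : 0 < T)
    (g : ℝ → ContMDiffRiemannianMetric (𝓡 n) ∞ (EuclideanSpace ℝ (Fin n))
      (fun x : M => TangentSpace (𝓡 n) x))
    (α : ℝ → TwoTensor n M)
    (hg : SmoothTensorOn (Icc 0 T) (fun t => (g t).inner))
    (hα : SmoothTensorOn (Icc 0 T) α)
    (hα_symm : ∀ t ∈ Icc 0 T, ∀ (x : M) (X Y : TangentSpace (𝓡 n) x), α t x X Y = α t x Y X)
    (hflow : ∀ t ∈ Icc 0 T, ∀ (x : M) (X Y : TangentSpace (𝓡 n) x),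
      HasDerivWithinAt (fun s => (g s).inner x X Y) (-2 * α t x X Y) (Icc 0 T) t)
    (f u v : ℝ → M → ℝ)
    (hf : SmoothFunOn n (Ico 0 T) f)
    (hu : ∀ t ∈ Ico 0 T, ∀ x : M,
      u t x = (4 * Real.pi * (T - t)) ^ (-(n : ℝ) / 2) * Real.exp (-f t x))
    (hu_heat : ∀ t ∈ Ico 0 T, ∀ x : M, conjHeat T (fun s => (g s).inner) α u t x = 0)
    (hv : ∀ t ∈ Ico 0 T, ∀ x : M,
      v t x = ((T - t) * (2 * laplaceBeltrami (g t).inner (f t) x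
          - (g t).inner x (riemGradient (g t).inner (f t) x) (riemGradient (g t).inner (f t) x)
          + traceOf (g t).inner (α t) x) + f t x - n) * u t x) :
    SmoothFunOn n (Ico 0 T) v ∧
      ∀ t ∈ Ico 0 T, ∀ x : M,
        conjHeat T (fun s => (g s).inner) α v t x =
          -2 * (T - t) * u t x *
              coordNormSq (tensorAt (g t).inner x)
                (tensorAt (α t) x + hessAt (g t).inner (f t) x
                  - (1 / (2 * (T - t))) • tensorAt (g t).inner x)
            - (T - t) * u t x *
              muellerD T (fun s => (g s).inner) α t x (riemGradient (g t).inner (f t) x) := by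
  have hI : Ico 0 T ⊆ Icc 0 T := Ico_subset_Icc_self
  have hO' (x : M) := (chartAt (EuclideanSpace ℝ (Fin n)) x).open_source
  have hloc := fun x : M => entropyDensity_local x (chartAt (EuclideanSpace ℝ (Fin n)) x).open_source
    le_rfl g α (hg.mono hI) (hα.mono hI) (fun t ht => hα_symm t (hI ht))
    (fun t ht x X Y => (hflow t (hI ht) x X Y).mono hI) f u v hf hu hu_heat hv
    ((uniqueDiffOn_Ico 0 T).prod
      (isOpen_chartImage x (chartAt (EuclideanSpace ℝ (Fin n)) x).open_source).uniqueDiffOn)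
  constructor
  · rintro ⟨t, x⟩ ⟨ht, -⟩
    obtain ⟨𝔤, φ, υ, ψ, τ, σ, -, -, -, hψ, -⟩ := hloc x
    have hx := mem_chart_source (EuclideanSpace ℝ (Fin n)) x
    -- Smoothness is local: times in `[0, T)` and points of the chart domain form a neighbourhood of
    -- `(t, x)` within `[0, T) × M`.
    refine (contMDiffOn_of_localFun le_rfl ψ hψ (t, x) ⟨ht, hx⟩).mono_of_mem_nhdsWithin ?_
    have h1 : univ ×ˢ (chartAt (EuclideanSpace ℝ (Fin n)) x).source ∈ nhds (t, x) :=
      prod_mem_nhds Filter.univ_mem ((chartAt (EuclideanSpace ℝ (Fin n)) x).open_source.mem_nhds hx)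
    filter_upwards [mem_nhdsWithin_of_mem_nhds h1, self_mem_nhdsWithin] with z hz hz'
    exact ⟨hz'.1, hz.2⟩
  · intro t ht x
    obtain ⟨𝔤, φ, υ, ψ, τ, σ, h, hφ, hυ, hψ, hτ, hσ, key⟩ := hloc x
    have hx := mem_chart_source (EuclideanSpace ℝ (Fin n)) x
    let q : ↥(Ico 0 T ×ˢ chartImage n x (chartAt (EuclideanSpace ℝ (Fin n)) x).source) :=
      ⟨(t, extChartAt (𝓡 n) x x), ht, extChartAt_mem_chartImage hx hx⟩
    have hsymm : (extChartAt (𝓡 n) x).symm (extChartAt (𝓡 n) x x) = x :=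
      extChartAt_symm_extChartAt hx
    have hO := hO' x
    have hA : ∀ q i j, smoothRing.ev q (localMatrix x
        (chartAt (EuclideanSpace ℝ (Fin n)) x).source (hα.mono hI) i j) =
        localTensor (α q.1.1) x q.1.2 i j := fun _ _ _ => rfl
    have h1 := congrArg (smoothRing.ev q) key
    have h2 := ev_mueller (hO := hO) ((uniqueDiffOn_Ico 0 T).prod (isOpen_chartImage x
      (chartAt (EuclideanSpace ℝ (Fin n)) x).open_source).uniqueDiffOn) h le_rfl hA hφ ht hx
    -- At the centre of the chart at `x` the components `tensorAt` and `hessAt` are by definition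
    -- the local ones.
    have h3 := h.inner_eq q (A := localMatrix x (chartAt (EuclideanSpace ℝ (Fin n)) x).source
        (hα.mono hI) + 𝔤.hess φ - σ • 𝔤.G)
      (C := tensorAt (α t) x + hessAt (g t).inner (f t) x
        - (1 / (2 * (T - t))) • tensorAt (g t).inner x) (fun i j => by
          have e1 := h.hess_eq (W := fun t => localFun (f t) x) hφ q i j
          rw [Matrix.sub_apply, Matrix.add_apply, Matrix.smul_apply, smul_eq_mul, map_sub, map_add,
            map_mul, hA, hσ, h.G_eq, e1]
          rfl)
    rw [ev_conjHeat (hO := hO) _ h le_rfl hA hψ, map_sub, map_mul, map_mul, map_mul, map_mul, map_mul, h2, h3,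
      hτ, hυ, map_neg, map_ofNat] at h1
    simp only [q, localFun, hsymm] at h1
    exact h1
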